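/- Let $K\ge 2$, $\mathcal T=\{0,\dots,K-1\}$, fix $t\in\mathcal T$, and let $(T_i,X_i)$, $i=1,\dots,n$ ($n\ge1$), be i.i.d. copies of $(T,X)$ with $T\in\mathcal T$. Put $R^{(k)}=1\{T=k\}$, let $f=(f_0,\dots,f_p)^{\top}$ be known measurable functions with $f_0\equiv1$, and let $\tilde{\mathrm E}$ be the sample average. For a $(p+1)\times K$ matrix $\gamma=(\gamma_0,\dots,\gamma_{K-1})$ with rows $\gamma_{j\cdot}^{\top}$, $j=0,\dots,p$, let $\|\gamma\|_{2,1}=\sum_{j=0}^p\|\gamma_{j\cdot}\|_2$ and $$\pi(k,X;\gamma)=\frac{e^{\gamma_k^{\top}f(X)}}{\sum_{l\in\mathcal T}e^{\gamma_l^{\top}f(X)}},\qquad \ell_{\rm CAL}(\gamma)=\tilde{\mathrm E}\sum_{k\ne t}\Big\{R^{(t)}e^{(\gamma_k-\gamma_t)^{\top}f(X)}-R^{(k)}(\gamma_k-\gamma_t)^{\top}f(X)\Big\}.$$ Let $\bar\gamma$ be a minimizer of $\mathrm E\{\ell_{\rm CAL}(\gamma)\}$ subject to $\sum_{k\in\mathcal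 T}\gamma_k=0$ (assumed to exist), and let $S_\gamma=\{0\}\cup\{1\le j\le p:\bar\gamma_{j\cdot}\ne0\}$. Let $\hat\gamma$ be a minimizer of $\ell_{\rm CAL}(\gamma)+\lambda_1\sum_{j=1}^p\|\gamma_{j\cdot}\|_2$ subject to $\sum_{k\in\mathcal T}\gamma_k=0$, where $$\lambda_1=A_1\tilde\lambda_1,\qquad \tilde\lambda_1=8B_0^2B_1\sqrt{K/n+\log\{(p+1)/\epsilon\}/n},\qquad 0<\epsilon<1.$$ Let $D_{\rm CAL}(\gamma,\gamma')=\ell_{\rm CAL}(\gamma)-\ell_{\rm CAL}(\gamma')-\sum_{k\in\mathcal T}(\gamma_k-\gamma'_k)^{\top}\frac{\partial}{\partial\gamma'_k}\ell_{\rm CAL}(\gamma')$ and $D^\dagger_{\rm CAL}(\gamma,\gamma')=D_{\rm CAL}(\gamma,\gamma')+D_{\rm CAL}(\gamma',\gamma)$. Let $H(X;\gamma)$ be the symmetric $K\times K$ matrix with diagonal entries $\pi(k,X;\gamma)$ for $k\neq t$ and $1-\pi(t,X;\gamma)$ for $k=t$, with $(k,t)$ and $(t,k)$ entries $-\pi(k,X;\gamma)$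 for $k\ne t$, and with all other entries $0$. Suppose that, for some constants $B_0\ge1$, $B_1>1$, $\nu_1>0$, $\xi_1>1$, $\eta_{1,1},\eta_{1,2}\in(0,1)$ and $A_1>(\xi_1+1)/(\xi_1-1)$: (i) $\sup_{1\le j\le p}|f_j(X)|\le B_0$ almost surely; (ii) $\pi^{-1}(t,X;\bar\gamma)\le B_1$ almost surely; (iii) for every $(p+1)\times K$ matrix $b=(b_0,\dots,b_{K-1})$ with $\sum_{k\in\mathcal T}b_k=0$ and $\sum_{j\notin S_\gamma}\|b_{j\cdot}\|_2\le\xi_1\sum_{j\in S_\gamma}\|b_{j\cdot}\|_2$, $$\nu_1^2\Big(\sum_{j\in S_\gamma}\|b_{j\cdot}\|_2\Big)^2\le|S_\gamma|\,\mathrm E\Big\{f^{\top}(X)\,b\,\frac{R^{(t)}}{\pi(t,X;\bar\gamma)}H(X;\bar\gamma)\,b^{\top}f(X)\Big\};$$ (iv) (a) $(\xi_1+1)^2\nu_1^{-2}|S_\gamma|(K-1)\tilde\lambda_1\le\eta_{1,1}$, and (b) $2B_0(\xi_1+1)^2(A_1-1)(1-\eta_{1,1})^{-1}\nu_1^{-2}|S_\gamma|\tilde\lambda_1\le\eta_{1,2}$.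 Then, with probability at least $1-3\epsilon$, a minimizer $\hat\gamma$ exists and every such minimizer satisfies $$D^\dagger_{\rm CAL}(\hat\gamma,\bar\gamma)+(A_1-1)\tilde\lambda_1\|\hat\gamma-\bar\gamma\|_{2,1}\le\xi_{1,1}^2\nu_{1,1}^{-2}|S_\gamma|\tilde\lambda_1^2,$$ where $\xi_{1,1}=(\xi_1+1)(A_1-1)$ and $\nu_{1,1}=\nu_1(1-\eta_{1,1})^{1/2}(1-\eta_{1,2})^{1/2}$. -/

import Mathlib

open MeasureTheory ProbabilityTheory

namespace RCAL

noncomputable section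

/-- Coefficient matrices `γ = (γ_0, …, γ_{K-1})` of size `(p+1) × K`; `γ j k` is the coefficient of
the regressor `f_j` for treatment `k`, and `γ j` is the row `γ_{j·}`. -/
abbrev Coef (p K : ℕ) : Type := Fin (p + 1) → Fin K → ℝ

/-- The treatment indicator `R^{(k)} = 1{T = k}`. -/
def ind {K : ℕ} (k T : Fin K) : ℝ := if T = k then 1 else 0

/-- The linear predictor `γ_kᵀ f(x)`. -/
def lin {p K : ℕ} {𝒳 : Type*} (f : Fin (p + 1) → 𝒳 → ℝ) (γ : Coef p K) (k : Fin K) (x : 𝒳) : ℝ :=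
  ∑ j, γ j k * f j x

/-- The multi-class logistic propensity score `π(k, x; γ)`. -/
def propensity {p K : ℕ} {𝒳 : Type*} (f : Fin (p + 1) → 𝒳 → ℝ) (k : Fin K) (x : 𝒳)
    (γ : Coef p K) : ℝ :=
  Real.exp (lin f γ k x) / ∑ l, Real.exp (lin f γ l x)

/-- The contribution of one observation `z = (T, x)` to the calibration loss for treatment `t`:
`∑_{k ≠ t} { R^{(t)} exp((γ_k - γ_t)ᵀ f(x)) - R^{(k)} (γ_k - γ_t)ᵀ f(x) }`. -/
def pointLoss {p K : ℕ} {𝒳 : Type*} (f : Fin (p + 1) → 𝒳 → ℝ) (t : Fin K) (γ : Coef p K)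
    (z : Fin K × 𝒳) : ℝ :=
  ∑ k ∈ Finset.univ.erase t,
    (ind t z.1 * Real.exp (lin f γ k z.2 - lin f γ t z.2)
      - ind k z.1 * (lin f γ k z.2 - lin f γ t z.2))

/-- The sample calibration loss `ℓ_CAL(γ)` at the data `z`. -/
def calLoss {p K n : ℕ} {𝒳 : Type*} (f : Fin (p + 1) → 𝒳 → ℝ) (t : Fin K)
    (z : Fin n → Fin K × 𝒳) (γ : Coef p K) : ℝ :=
  (n : ℝ)⁻¹ * ∑ i, pointLoss f t γ (z i)

/-- The expected calibration loss `E ℓ_CAL(γ)`, where `Q` is the law of `(T, X)`. -/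
def expLoss {p K : ℕ} {𝒳 : Type*} [MeasurableSpace 𝒳] (f : Fin (p + 1) → 𝒳 → ℝ) (t : Fin K)
    (Q : Measure (Fin K × 𝒳)) (γ : Coef p K) : ℝ :=
  ∫ z, pointLoss f t γ z ∂Q

/-- The sum-to-zero constraint `∑_k γ_k = 0`. -/
def SumToZero {p K : ℕ} (γ : Coef p K) : Prop := ∀ j, ∑ k, γ j k = 0

/-- The Euclidean norm `‖γ_{j·}‖₂` of a row. -/
def rowNorm {p K : ℕ} (γ : Coef p K) (j : Fin (p + 1)) : ℝ := ‖WithLp.toLp 2 (γ j)‖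

/-- The group norm `‖γ‖_{2,1} = ∑_{j=0}^p ‖γ_{j·}‖₂`. -/
def norm21 {p K : ℕ} (γ : Coef p K) : ℝ := ∑ j, rowNorm γ j

/-- The penalized objective `ℓ_CAL(γ) + lam ∑_{j=1}^p ‖γ_{j·}‖₂` (intercepts unpenalized). -/
def penLoss {p K n : ℕ} {𝒳 : Type*} (f : Fin (p + 1) → 𝒳 → ℝ) (t : Fin K)
    (z : Fin n → Fin K × 𝒳) (lam : ℝ) (γ : Coef p K) : ℝ :=
  calLoss f t z γ + lam * ∑ j ∈ Finset.univ.erase (0 : Fin (p + 1)), rowNorm γ j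

/-- `γ` is a regularized calibrated estimate from the data `z`: a minimizer of the penalized
objective subject to the sum-to-zero constraint. -/
def IsRCALEstimate {p K n : ℕ} {𝒳 : Type*} (f : Fin (p + 1) → 𝒳 → ℝ) (t : Fin K)
    (z : Fin n → Fin K × 𝒳) (lam : ℝ) (γ : Coef p K) : Prop :=
  SumToZero γ ∧ ∀ γ' : Coef p K, SumToZero γ' → penLoss f t z lam γ ≤ penLoss f t z lam γ'

/-- `γ` is a target value: a minimizer of the expected calibration loss subject to the
sum-to-zero constraint. -/
def IsCALTarget {p K : ℕ} {𝒳 : Type*} [MeasurableSpace 𝒳] (f : Fin (p + 1) → 𝒳 → ℝ) (t : Fin K)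
    (Q : Measure (Fin K × 𝒳)) (γ : Coef p K) : Prop :=
  SumToZero γ ∧ ∀ γ' : Coef p K, SumToZero γ' → expLoss f t Q γ ≤ expLoss f t Q γ'

/-- The Bregman divergence `D_CAL(γ, γ')` of the sample calibration loss; the derivative is taken
with respect to all entries of the matrix. -/
def bregman {p K n : ℕ} {𝒳 : Type*} (f : Fin (p + 1) → 𝒳 → ℝ) (t : Fin K)
    (z : Fin n → Fin K × 𝒳) (γ γ' : Coef p K) : ℝ :=
  calLoss f t z γ - calLoss f t z γ' - fderiv ℝ (calLoss f t z) γ' (γ - γ')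

/-- The symmetrized Bregman divergence `D†_CAL(γ, γ')`. -/
def symBregman {p K n : ℕ} {𝒳 : Type*} (f : Fin (p + 1) → 𝒳 → ℝ) (t : Fin K)
    (z : Fin n → Fin K × 𝒳) (γ γ' : Coef p K) : ℝ :=
  bregman f t z γ γ' + bregman f t z γ' γ

open Classical in
/-- The set `S_γ = {0} ∪ {j ≥ 1 : γ_{j·} ≠ 0}`. -/
def activeSet {p K : ℕ} (γ : Coef p K) : Finset (Fin (p + 1)) :=
  Finset.univ.filter fun j => j = 0 ∨ γ j ≠ 0

/-- The `K × K` matrix `H(x; γ)`: its diagonal entries are `π(k, x; γ)` for `k ≠ t` and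
`1 - π(t, x; γ)` for `k = t`; the off-diagonal entries `(k, t)` and `(t, k)` are `-π(k, x; γ)`;
all other entries vanish. -/
def hessMat {p K : ℕ} {𝒳 : Type*} (f : Fin (p + 1) → 𝒳 → ℝ) (t : Fin K) (x : 𝒳)
    (γ : Coef p K) : Matrix (Fin K) (Fin K) ℝ :=
  Matrix.of fun k l =>
    if k = l then (if k = t then 1 - propensity f t x γ else propensity f k x γ)
    else if k = t then - propensity f l x γ
    else if l = t then - propensity f k x γ
    else 0

/-- `E { f(X)ᵀ b (R^{(t)} / π(t, X; γ)) H(X; γ) bᵀ f(X) }`. -/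
def hessForm {p K : ℕ} {𝒳 : Type*} [MeasurableSpace 𝒳] (f : Fin (p + 1) → 𝒳 → ℝ) (t : Fin K)
    (Q : Measure (Fin K × 𝒳)) (γ b : Coef p K) : ℝ :=
  ∫ z : Fin K × 𝒳, ind t z.1 / propensity f t z.2 γ *
    ((fun k => lin f b k z.2) ⬝ᵥ
      Matrix.mulVec (hessMat f t z.2 γ) (fun k => lin f b k z.2)) ∂Q

/-- The theoretical compatibility condition under the sum-to-zero constraint, at `γ`, with the
subset `S` and the constants `ν` and `ξ`. -/
def Compatibility {p K : ℕ} {𝒳 : Type*} [MeasurableSpace 𝒳] (f : Fin (p + 1) → 𝒳 → ℝ) (t : Fin K)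
    (Q : Measure (Fin K × 𝒳)) (γ : Coef p K) (S : Finset (Fin (p + 1))) (ν ξ : ℝ) : Prop :=
  ∀ b : Coef p K, SumToZero b →
    ∑ j ∈ Sᶜ, rowNorm b j ≤ ξ * ∑ j ∈ S, rowNorm b j →
    ν ^ 2 * (∑ j ∈ S, rowNorm b j) ^ 2 ≤ (S.card : ℝ) * hessForm f t Q γ b

/-- The rate `8 B₀² B₁ √(K / n + log((p + 1) / ε) / n)`. -/
def tuning (p K n : ℕ) (B₀ B₁ ε : ℝ) : ℝ :=
  8 * B₀ ^ 2 * B₁ * Real.sqrt ((K : ℝ) / n + Real.log (((p : ℝ) + 1) / ε) / n)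

end

end RCAL

open RCAL

namespace RCAL

/-! The argument separates a deterministic inequality on a good event from the probability of that
event. Write `D` for the symmetrized divergence between estimate and target, `N` for the group norm
of their difference, `s` for its part on the active rows, and `lt` for the tuning rate. The good
event asks that the regressors be bounded at the sample points, that every row of the score at the
target have norm at most `lt`, and that the sample Hessian form fall below the population one by at
most `(K - 1) * lt * N ^ 2`.

On this event, optimality along the segment to the target gives `D + (A - 1) * lt * N ≤ (ξ + 1) * (A
- 1) * lt * s` and the cone condition. Compatibility bounds `s` by the population Hessian, hence by
the sample Hessian, and the latter is compared with `D` through the elementary bound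
`one_sub_exp_neg_mul_sq_le`. The comparison factor degrades as `N` grows, but the second smallness
condition makes the estimate self-bounding: `oracle_arith` first bounds `N` absolutely, then cancels
the factor. The absolute bound also gives existence: a minimizer over a slightly larger ball must be
interior, so by convexity it is global (`exists_isRCALEstimate`).

For the probability, the rows of the score are centred because the target is a constrained minimizer
(`integral_rowGrad_eq_zero`) and their norm is bounded independently of `K` (`norm_rowGrad_le`), so
a Hilbert space Hoeffding inequality (`measure_norm_sum_ge_le`) applies. The Hessian weights are
handled by scalar Hoeffding, and `union_bound_arith` sums the tails. Each family costs at most `ε`.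
-/

/-! ### Hyperbolic cosine and Hoeffding's inequality in Hilbert space -/

/-- The power series of `cosh` has only even powers and nonnegative coefficients, so `cosh` is a
convex function of the squared argument; convexity is applied term by term. -/
theorem cosh_le_of_sq_eq {u v c α β : ℝ} (hα : 0 ≤ α) (hβ : 0 ≤ β) (hαβ : α + β = 1)
    (h : c ^ 2 = α * u ^ 2 + β * v ^ 2) :
    Real.cosh c ≤ α * Real.cosh u + β * Real.cosh v := by
  refine hasSum_le (fun m => ?_) (Real.hasSum_cosh c)
    (((Real.hasSum_cosh u).mul_left α).add ((Real.hasSum_cosh v).mul_left β))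
  have := (convexOn_pow (𝕜 := ℝ) m).2 (sq_nonneg u) (sq_nonneg v) hα hβ hαβ
  simp only [smul_eq_mul] at this
  rw [pow_mul, pow_mul, pow_mul, h, ← mul_div_assoc, ← mul_div_assoc, ← add_div]
  gcongr

theorem exp_sub_le_exp_sq {x : ℝ} (hx : 0 ≤ x) : Real.exp x - x ≤ Real.exp (x ^ 2) := by
  rcases le_total x 1 with h | h
  · have := (abs_le.1 (Real.abs_exp_sub_one_sub_id_le (abs_le.2 ⟨by linarith, h⟩))).2
    linarith [Real.add_one_le_exp (x ^ 2)]
  · have : Real.exp x ≤ Real.exp (x ^ 2) := Real.exp_le_exp.2 (by nlinarith)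
    linarith

theorem integrable_cosh_norm {E : Type*} [NormedAddCommGroup E] [MeasurableSpace E] [BorelSpace E]
    {Ω : Type*} [MeasurableSpace Ω] {P : Measure Ω} [IsProbabilityMeasure P] {S : Ω → E}
    (hS : AEMeasurable S P) {C : ℝ}
    (hC : ∀ᵐ ω ∂P, ‖S ω‖ ≤ C) : Integrable (fun ω => Real.cosh ‖S ω‖) P := by
  refine Integrable.of_bound (C := Real.cosh C) ?_ ?_
  · exact (Real.continuous_cosh.measurable.comp_aemeasurable hS.norm).aestronglyMeasurable
  · filter_upwards [hC] with ω h
    rw [Real.norm_eq_abs, abs_of_pos (Real.cosh_pos _)]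
    exact Real.cosh_le_cosh.2 (by rw [abs_of_nonneg (norm_nonneg _)]; exact h.trans (le_abs_self C))

section Hilbert

variable {E : Type*} [NormedAddCommGroup E] [InnerProductSpace ℝ E]

/-- With `θ` the cosine of the angle, `‖s + x‖ ^ 2` is the average of `(‖s‖ + ‖x‖) ^ 2` and `(‖s‖ -
‖x‖) ^ 2` with weights `(1 ± θ) / 2`; the addition formulas finish. Division by zero being zero
covers the degenerate cases. -/
theorem cosh_norm_add_le (s x : E) :
    Real.cosh ‖s + x‖ ≤ Real.cosh ‖s‖ * Real.cosh ‖x‖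
      + inner ℝ s x * (Real.sinh ‖s‖ / ‖s‖) * (Real.sinh ‖x‖ / ‖x‖) := by
  by_cases hs : s = 0
  · simp [hs]
  by_cases hx : x = 0
  · simp [hx]
  have hs' : 0 < ‖s‖ := norm_pos_iff.2 hs
  have hx' : 0 < ‖x‖ := norm_pos_iff.2 hx
  have hin := abs_le.1 (abs_real_inner_le_norm s x)
  have hp : 0 < ‖s‖ * ‖x‖ := by positivity
  set θ := inner ℝ s x / (‖s‖ * ‖x‖) with hθ
  have hin' : inner ℝ s x = θ * (‖s‖ * ‖x‖) := by rw [hθ]; field_simp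
  have h1 : θ ≤ 1 := by rw [hθ, div_le_one hp]; exact hin.2
  have h2 : -1 ≤ θ := by rw [hθ, le_div_iff₀ hp]; linarith [hin.1]
  have key := cosh_le_of_sq_eq (u := ‖s‖ + ‖x‖) (v := ‖s‖ - ‖x‖) (c := ‖s + x‖)
    (α := (1 + θ) / 2) (β := (1 - θ) / 2) (by linarith) (by linarith) (by ring)
    (by rw [norm_add_sq_real, hin']; ring)
  refine key.trans (le_of_eq ?_)
  rw [Real.cosh_add, Real.cosh_sub, hin']
  field_simp
  ring

/-- The remainder must be linear in `x`, so that it disappears on averaging over a centred `x`.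
Replacing `sinh ‖x‖ / ‖x‖` by `1` costs at most `cosh ‖s‖ * (sinh ‖x‖ - ‖x‖)` by Cauchy–Schwarz, and
`exp ‖x‖ - ‖x‖ ≤ exp (‖x‖ ^ 2)` absorbs it. -/
theorem cosh_norm_add_le_exp (s x : E) :
    Real.cosh ‖s + x‖ ≤ Real.cosh ‖s‖ * Real.exp (‖x‖ ^ 2)
      + inner ℝ ((Real.sinh ‖s‖ / ‖s‖) • s) x := by
  have h := cosh_norm_add_le s x
  rw [real_inner_smul_left]
  by_cases hs : s = 0
  · simp only [hs, zero_add, norm_zero, Real.cosh_zero, one_mul, inner_zero_left, mul_zero,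
      add_zero]
    linarith [Real.cosh_add_sinh ‖x‖, Real.self_le_sinh_iff.2 (norm_nonneg x),
      exp_sub_le_exp_sq (norm_nonneg x)]
  by_cases hx : x = 0
  · simp [hx]
  have hs' : 0 < ‖s‖ := norm_pos_iff.2 hs
  have hx' : 0 < ‖x‖ := norm_pos_iff.2 hx
  set a := Real.sinh ‖s‖ / ‖s‖ with ha
  have ha0 : 0 ≤ a := by have := Real.sinh_nonneg_iff.2 hs'.le; positivity
  have has : a * ‖s‖ = Real.sinh ‖s‖ := by rw [ha]; field_simp
  have hq : 0 ≤ Real.sinh ‖x‖ / ‖x‖ - 1 := by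
    rw [sub_nonneg, one_le_div hx']; exact Real.self_le_sinh_iff.2 hx'.le
  have hqx : (Real.sinh ‖x‖ / ‖x‖ - 1) * ‖x‖ = Real.sinh ‖x‖ - ‖x‖ := by field_simp
  have h3 : inner ℝ s x * a * (Real.sinh ‖x‖ / ‖x‖ - 1)
      ≤ Real.sinh ‖s‖ * (Real.sinh ‖x‖ - ‖x‖) := by
    calc _ ≤ ‖s‖ * ‖x‖ * a * (Real.sinh ‖x‖ / ‖x‖ - 1) := by
          gcongr; exact real_inner_le_norm s x
      _ = _ := by rw [← hqx, ← has]; ring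
  have h4 : Real.sinh ‖s‖ * (Real.sinh ‖x‖ - ‖x‖) ≤ Real.cosh ‖s‖ * (Real.sinh ‖x‖ - ‖x‖) :=
    mul_le_mul_of_nonneg_right (Real.sinh_lt_cosh _).le
      (sub_nonneg.2 (Real.self_le_sinh_iff.2 hx'.le))
  have h5 : Real.cosh ‖s‖ * (Real.cosh ‖x‖ + Real.sinh ‖x‖ - ‖x‖)
      ≤ Real.cosh ‖s‖ * Real.exp (‖x‖ ^ 2) := by
    rw [Real.cosh_add_sinh]
    exact mul_le_mul_of_nonneg_left (exp_sub_le_exp_sq hx'.le) (Real.cosh_pos _).le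
  nlinarith

variable [CompleteSpace E] [SecondCountableTopology E] [MeasurableSpace E] [BorelSpace E]
  {Ω : Type*} [MeasurableSpace Ω] {P : Measure Ω} [IsProbabilityMeasure P]

/-- One inductive step for sums: independence and centring kill the integral of the term linear in
`X`. -/
theorem integral_cosh_norm_add_le {S X : Ω → E} (hS : AEMeasurable S P) (hX : AEMeasurable X P)
    (hind : IndepFun S X P) {C M : ℝ} (hC : ∀ᵐ ω ∂P, ‖S ω‖ ≤ C) (hM : ∀ᵐ ω ∂P, ‖X ω‖ ≤ M)
    (h0 : ∫ ω, X ω ∂P = 0) :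
    ∫ ω, Real.cosh ‖S ω + X ω‖ ∂P ≤ (∫ ω, Real.cosh ‖S ω‖ ∂P) * Real.exp (M ^ 2) := by
  set g : E → E := fun s => (Real.sinh ‖s‖ / ‖s‖) • s with hg
  have hgm : Measurable g := by
    have : Measurable fun s : E => Real.sinh ‖s‖ / ‖s‖ :=
      (Real.continuous_sinh.measurable.comp measurable_norm).div measurable_norm
    exact this.smul measurable_id
  have hgn : ∀ s, ‖g s‖ = Real.sinh ‖s‖ := by
    intro s
    by_cases hs : s = 0
    · simp [hg, hs]
    have : 0 < ‖s‖ := norm_pos_iff.2 hs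
    simp only [hg, norm_smul, norm_div, Real.norm_eq_abs,
      abs_of_nonneg (Real.sinh_nonneg_iff.2 this.le), abs_of_pos this]
    field_simp
  have hgS : AEMeasurable (fun ω => g (S ω)) P := hgm.comp_aemeasurable hS
  have hgi : Integrable (fun ω => g (S ω)) P := by
    refine Integrable.of_bound (C := Real.sinh C) hgS.aestronglyMeasurable ?_
    filter_upwards [hC] with ω h
    rw [hgn]; exact Real.sinh_le_sinh.2 h
  have hXi : Integrable X P := Integrable.of_bound (C := M) hX.aestronglyMeasurable hM
  have hind' : IndepFun (fun ω => g (S ω)) X P := hind.comp hgm measurable_id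
  have hzero : ∫ ω, inner ℝ (g (S ω)) (X ω) ∂P = 0 := by
    have := hind'.integral_bilin hgi hXi (innerSL ℝ)
    rw [h0, map_zero] at this
    exact this
  have hinni : Integrable (fun ω => inner ℝ (g (S ω)) (X ω)) P := by
    refine Integrable.of_bound (C := Real.sinh C * M) ?_ ?_
    · exact hgS.aestronglyMeasurable.inner hX.aestronglyMeasurable
    · filter_upwards [hC, hM] with ω h h'
      refine (norm_inner_le_norm _ _).trans ?_
      rw [hgn]
      have := Real.sinh_nonneg_iff.2 (norm_nonneg (S ω))
      exact mul_le_mul (Real.sinh_le_sinh.2 h) h' (norm_nonneg _)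
        (this.trans (Real.sinh_le_sinh.2 h))
  have hci := integrable_cosh_norm hS hC
  have hci' : Integrable (fun ω => Real.cosh ‖S ω + X ω‖) P := by
    refine integrable_cosh_norm (C := C + M) (hS.add hX) ?_
    filter_upwards [hC, hM] with ω h h'
    exact (norm_add_le _ _).trans (add_le_add h h')
  calc _ ≤ ∫ ω, (Real.cosh ‖S ω‖ * Real.exp (M ^ 2) + inner ℝ (g (S ω)) (X ω)) ∂P := by
        refine integral_mono_ae hci' ((hci.mul_const _).add hinni) ?_
        filter_upwards [hM] with ω h
        refine (cosh_norm_add_le_exp _ _).trans ?_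
        have := Real.cosh_pos ‖S ω‖
        simp only [hg]
        gcongr
    _ = _ := by
        rw [integral_add (hci.mul_const _) hinni, hzero, integral_mul_const, add_zero]

theorem integral_cosh_norm_sum_le {ι : Type*} (X : ι → Ω → E) (hX : ∀ i, AEMeasurable (X i) P)
    (hind : iIndepFun X P) {M : ℝ} (hM : ∀ i, ∀ᵐ ω ∂P, ‖X i ω‖ ≤ M)
    (h0 : ∀ i, ∫ ω, X i ω ∂P = 0) (s : Finset ι) :
    ∫ ω, Real.cosh ‖∑ i ∈ s, X i ω‖ ∂P ≤ Real.exp (s.card * M ^ 2) := by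
  classical
  induction s using Finset.induction_on with
  | empty => simp
  | insert a s ha ih =>
    have hS : AEMeasurable (fun ω => ∑ i ∈ s, X i ω) P :=
      Finset.aemeasurable_fun_sum s fun i _ => hX i
    have hb : ∀ᵐ ω ∂P, ‖∑ i ∈ s, X i ω‖ ≤ s.card * M := by
      have : ∀ᵐ ω ∂P, ∀ i ∈ s, ‖X i ω‖ ≤ M := (ae_ball_iff s.countable_toSet).2 fun i _ => hM i
      filter_upwards [this] with ω h
      simpa using norm_sum_le_of_le s h
    have hi : IndepFun (fun ω => ∑ i ∈ s, X i ω) (X a) P := by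
      have := hind.indepFun_finsetSum_of_notMem₀ hX ha
      convert this using 1
      ext ω; simp
    have := integral_cosh_norm_add_le hS (hX a) hi hb (hM a) (h0 a)
    simp only [Finset.sum_insert ha, Finset.card_insert_of_notMem ha]
    calc _ = ∫ ω, Real.cosh ‖∑ i ∈ s, X i ω + X a ω‖ ∂P := by simp only [add_comm]
      _ ≤ _ := this
      _ ≤ Real.exp (s.card * M ^ 2) * Real.exp (M ^ 2) := by gcongr
      _ = _ := by rw [← Real.exp_add]; congr 1; push_cast; ring

/-- Hoeffding's inequality for independent, bounded, centred Hilbert space valued variables. -/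
theorem measure_norm_sum_ge_le {ι : Type*} [Fintype ι] (X : ι → Ω → E)
    (hX : ∀ i, AEMeasurable (X i) P)
    (hind : iIndepFun X P) {M : ℝ} (hM : ∀ i, ∀ᵐ ω ∂P, ‖X i ω‖ ≤ M)
    (h0 : ∀ i, ∫ ω, X i ω ∂P = 0) {l r : ℝ} (hl : 0 ≤ l) :
    P.real {ω | r ≤ ‖∑ i, X i ω‖}
      ≤ 2 * Real.exp (Fintype.card ι * (l * M) ^ 2 - l * r) := by
  have hX' : ∀ i, AEMeasurable (fun ω => l • X i ω) P := fun i => (hX i).const_smul l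
  have hM' : ∀ i, ∀ᵐ ω ∂P, ‖l • X i ω‖ ≤ l * M := fun i => by
    filter_upwards [hM i] with ω h
    rw [norm_smul, Real.norm_eq_abs, abs_of_nonneg hl]; gcongr
  have hind' : iIndepFun (fun i ω => l • X i ω) P :=
    hind.comp (fun _ x => l • x) fun _ => measurable_const_smul l
  have key := integral_cosh_norm_sum_le _ hX' hind' hM'
    (fun i => by rw [integral_smul, h0, smul_zero]) Finset.univ
  have hb : ∀ᵐ ω ∂P, ‖∑ i, l • X i ω‖ ≤ Fintype.card ι * (l * M) := by
    filter_upwards [ae_all_iff.2 hM'] with ω h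
    simpa using norm_sum_le_of_le Finset.univ (fun i _ => h i)
  have hint := integrable_cosh_norm (Finset.aemeasurable_fun_sum Finset.univ fun i _ => hX' i) hb
  have markov := mul_meas_ge_le_integral_of_nonneg
    (Filter.Eventually.of_forall fun ω => (Real.cosh_pos _).le) hint (Real.exp (l * r) / 2)
  have hsub : P.real {ω | r ≤ ‖∑ i, X i ω‖}
      ≤ P.real {ω | Real.exp (l * r) / 2 ≤ Real.cosh ‖∑ i, l • X i ω‖} := by
    refine measureReal_mono fun ω (h : r ≤ _) => ?_
    simp only [Set.mem_ofPred_eq, ← Finset.smul_sum, norm_smul, Real.norm_eq_abs, abs_of_nonneg hl]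
    rw [Real.cosh_eq]
    have h1 : Real.exp (l * r) ≤ Real.exp (l * ‖∑ i, X i ω‖) := by gcongr
    have h2 := Real.exp_pos (-(l * ‖∑ i, X i ω‖))
    linarith
  rw [Real.exp_sub, mul_div_assoc', le_div_iff₀ (Real.exp_pos _)]
  simp only [Finset.card_univ] at key
  have := mul_le_mul_of_nonneg_left hsub (Real.exp_pos (l * r)).le
  nlinarith

end Hilbert

/-! ### Row norms and the sum-to-zero subspace -/

section Rows

variable {p K : ℕ}

theorem rowNorm_nonneg (b : Coef p K) (j : Fin (p + 1)) : 0 ≤ rowNorm b j := norm_nonneg _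

theorem rowNorm_add_le (b c : Coef p K) (j : Fin (p + 1)) :
    rowNorm (b + c) j ≤ rowNorm b j + rowNorm c j := by
  simp only [rowNorm, Pi.add_apply, WithLp.toLp_add]
  exact norm_add_le _ _

theorem rowNorm_smul (r : ℝ) (b : Coef p K) (j : Fin (p + 1)) :
    rowNorm (r • b) j = |r| * rowNorm b j := by
  simp only [rowNorm, Pi.smul_apply, WithLp.toLp_smul, norm_smul, Real.norm_eq_abs]

theorem rowNorm_sub_comm (b c : Coef p K) (j : Fin (p + 1)) :
    rowNorm (b - c) j = rowNorm (c - b) j := by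
  rw [← neg_sub, ← neg_one_smul ℝ, rowNorm_smul]; simp

theorem abs_apply_le_rowNorm (b : Coef p K) (j : Fin (p + 1)) (k : Fin K) :
    |b j k| ≤ rowNorm b j :=
  PiLp.norm_apply_le (WithLp.toLp 2 (b j)) k

theorem rowNorm_sq (b : Coef p K) (j : Fin (p + 1)) : rowNorm b j ^ 2 = ∑ k, b j k ^ 2 := by
  simp [rowNorm, EuclideanSpace.norm_sq_eq]

theorem continuous_rowNorm (j : Fin (p + 1)) : Continuous fun b : Coef p K => rowNorm b j :=
  continuous_norm.comp ((PiLp.continuous_toLp 2 _).comp (continuous_apply j))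

theorem continuous_norm21 : Continuous (norm21 : Coef p K → ℝ) :=
  continuous_finsetSum _ fun j _ => continuous_rowNorm j

theorem convexOn_rowNorm (j : Fin (p + 1)) :
    ConvexOn ℝ Set.univ fun b : Coef p K => rowNorm b j := by
  refine ⟨convex_univ, fun x _ y _ a b ha hb _ => (rowNorm_add_le _ _ _).trans ?_⟩
  simp only [rowNorm_smul, abs_of_nonneg ha, abs_of_nonneg hb, smul_eq_mul, le_refl]

theorem norm21_nonneg (b : Coef p K) : 0 ≤ norm21 b :=
  Finset.sum_nonneg fun j _ => rowNorm_nonneg b j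

theorem norm21_smul (r : ℝ) (b : Coef p K) : norm21 (r • b) = |r| * norm21 b := by
  simp only [norm21, rowNorm_smul, Finset.mul_sum]

theorem norm_le_norm21 (b : Coef p K) : ‖b‖ ≤ norm21 b := by
  refine (pi_norm_le_iff_of_nonneg (norm21_nonneg b)).2 fun j =>
    (pi_norm_le_iff_of_nonneg (norm21_nonneg b)).2 fun k => ?_
  exact (abs_apply_le_rowNorm b j k).trans
    (Finset.single_le_sum (fun j _ => rowNorm_nonneg b j) (Finset.mem_univ j))

theorem SumToZero.add {b c : Coef p K} (hb : SumToZero b) (hc : SumToZero c) :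
    SumToZero (b + c) := fun j => by
  simp [Finset.sum_add_distrib, hb j, hc j]

theorem SumToZero.smul {b : Coef p K} (r : ℝ) (hb : SumToZero b) : SumToZero (r • b) := fun j => by
  simp [← Finset.mul_sum, hb j]

theorem SumToZero.sub {b c : Coef p K} (hb : SumToZero b) (hc : SumToZero c) :
    SumToZero (b - c) := fun j => by
  simp [hb j, hc j]

theorem isClosed_sumToZero : IsClosed {b : Coef p K | SumToZero b} := by
  simp only [SumToZero, Set.ofPred_forall]
  exact isClosed_iInter fun j => isClosed_eq (by fun_prop) continuous_const

theorem convex_sumToZero : Convex ℝ {b : Coef p K | SumToZero b} :=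
  fun _ hx _ hy a b _ _ _ => SumToZero.add (SumToZero.smul a hx) (SumToZero.smul b hy)

end Rows

/-! ### Derivatives, divergence and convexity of the sample loss -/

noncomputable section

variable {p K n : ℕ} {𝒳 : Type*}

/-- The linear predictor contrast `(γ_k - γ_t)ᵀ f(x)`. -/
def contrast (f : Fin (p + 1) → 𝒳 → ℝ) (t : Fin K) (γ : Coef p K) (k : Fin K) (x : 𝒳) : ℝ :=
  lin f γ k x - lin f γ t x

/-- The derivative of the loss of one observation at `γ` in the direction `b`. -/
def pointDeriv (f : Fin (p + 1) → 𝒳 → ℝ) (t : Fin K) (γ b : Coef p K) (z : Fin K × 𝒳) : ℝ :=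
  ∑ k ∈ Finset.univ.erase t,
    (ind t z.1 * Real.exp (contrast f t γ k z.2) - ind k z.1) * contrast f t b k z.2

/-- The derivative of the sample calibration loss at `γ` in the direction `b`. -/
def calDeriv (f : Fin (p + 1) → 𝒳 → ℝ) (t : Fin K) (z : Fin n → Fin K × 𝒳) (γ b : Coef p K) : ℝ :=
  (n : ℝ)⁻¹ * ∑ i, pointDeriv f t γ b (z i)

/-- The second derivative of the loss of one observation at `γ`, as a quadratic form. -/
def pointHess (f : Fin (p + 1) → 𝒳 → ℝ) (t : Fin K) (γ b : Coef p K) (z : Fin K × 𝒳) : ℝ :=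
  ∑ k ∈ Finset.univ.erase t,
    ind t z.1 * Real.exp (contrast f t γ k z.2) * contrast f t b k z.2 ^ 2

/-- The second derivative of the sample calibration loss at `γ`, as a quadratic form. -/
def sampleHess (f : Fin (p + 1) → 𝒳 → ℝ) (t : Fin K) (z : Fin n → Fin K × 𝒳)
    (γ b : Coef p K) : ℝ :=
  (n : ℝ)⁻¹ * ∑ i, pointHess f t γ b (z i)

theorem ind_nonneg (k l : Fin K) : 0 ≤ ind k l := by unfold ind; split_ifs <;> norm_num

theorem ind_le_one (k l : Fin K) : ind k l ≤ 1 := by unfold ind; split_ifs <;> norm_num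

theorem contrast_eq_sum (f : Fin (p + 1) → 𝒳 → ℝ) (t : Fin K) (γ : Coef p K) (k : Fin K) (x : 𝒳) :
    contrast f t γ k x = ∑ j, (γ j k - γ j t) * f j x := by
  simp only [contrast, lin, sub_mul, Finset.sum_sub_distrib]

theorem contrast_add (f : Fin (p + 1) → 𝒳 → ℝ) (t : Fin K) (γ b : Coef p K) (k : Fin K) (x : 𝒳) :
    contrast f t (γ + b) k x = contrast f t γ k x + contrast f t b k x := by
  simp only [contrast_eq_sum, ← Finset.sum_add_distrib, Pi.add_apply]
  exact Finset.sum_congr rfl fun j _ => by ring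

theorem contrast_smul (f : Fin (p + 1) → 𝒳 → ℝ) (t : Fin K) (r : ℝ) (b : Coef p K) (k : Fin K)
    (x : 𝒳) : contrast f t (r • b) k x = r * contrast f t b k x := by
  simp only [contrast_eq_sum, Finset.mul_sum, Pi.smul_apply, smul_eq_mul]
  exact Finset.sum_congr rfl fun j _ => by ring

theorem contrast_sub (f : Fin (p + 1) → 𝒳 → ℝ) (t : Fin K) (γ b : Coef p K) (k : Fin K) (x : 𝒳) :
    contrast f t (γ - b) k x = contrast f t γ k x - contrast f t b k x := by
  rw [sub_eq_add_neg, contrast_add, ← neg_one_smul ℝ, contrast_smul]; ring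

theorem abs_contrast_le (f : Fin (p + 1) → 𝒳 → ℝ) (t : Fin K) (b : Coef p K) (k : Fin K) (x : 𝒳)
    {B : ℝ} (hf : ∀ j, |f j x| ≤ B) : |contrast f t b k x| ≤ 2 * B * norm21 b := by
  rw [contrast_eq_sum, norm21, Finset.mul_sum]
  refine (Finset.abs_sum_le_sum_abs _ _).trans (Finset.sum_le_sum fun j _ => ?_)
  rw [abs_mul]
  have h1 := abs_sub (b j k) (b j t)
  have h2 := abs_apply_le_rowNorm b j k
  have h3 := abs_apply_le_rowNorm b j t
  calc _ ≤ (2 * rowNorm b j) * B := by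
        have := hf j
        have := rowNorm_nonneg b j
        gcongr
        linarith
    _ = _ := by ring

theorem calDeriv_neg (f : Fin (p + 1) → 𝒳 → ℝ) (t : Fin K) (z : Fin n → Fin K × 𝒳)
    (γ b c : Coef p K) : calDeriv f t z γ (b - c) = - calDeriv f t z γ (c - b) := by
  simp only [calDeriv, pointDeriv, contrast_sub]
  rw [← mul_neg, ← Finset.sum_neg_distrib]
  congr 1
  refine Finset.sum_congr rfl fun i _ => ?_
  rw [← Finset.sum_neg_distrib]
  exact Finset.sum_congr rfl fun k _ => by ring

theorem differentiable_lin (f : Fin (p + 1) → 𝒳 → ℝ) (k : Fin K) (x : 𝒳) :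
    Differentiable ℝ fun γ : Coef p K => lin f γ k x := by
  unfold lin; fun_prop

theorem differentiable_calLoss (f : Fin (p + 1) → 𝒳 → ℝ) (t : Fin K) (z : Fin n → Fin K × 𝒳) :
    Differentiable ℝ (calLoss f t z) := by
  have := differentiable_lin f (p := p) (K := K)
  unfold calLoss pointLoss
  fun_prop

theorem hasLineDerivAt_calLoss (f : Fin (p + 1) → 𝒳 → ℝ) (t : Fin K) (z : Fin n → Fin K × 𝒳)
    (γ b : Coef p K) : HasLineDerivAt ℝ (calLoss f t z) (calDeriv f t z γ b) γ b := by
  have hc : ∀ k x, HasDerivAt (fun s : ℝ => contrast f t (γ + s • b) k x)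
      (contrast f t b k x) 0 := fun k x => by
    simp only [contrast_add, contrast_smul]
    simpa using ((hasDerivAt_id (0 : ℝ)).mul_const (contrast f t b k x)).const_add
      (contrast f t γ k x)
  unfold HasLineDerivAt calLoss pointLoss calDeriv pointDeriv
  refine HasDerivAt.const_mul _ (HasDerivAt.fun_sum fun i _ => HasDerivAt.fun_sum fun k _ => ?_)
  have h1 := ((hc k (z i).2).exp.const_mul (ind t (z i).1)).sub
    ((hc k (z i).2).const_mul (ind k (z i).1))
  simp only [zero_smul, add_zero] at h1
  exact h1.congr_deriv (by ring)

theorem fderiv_calLoss (f : Fin (p + 1) → 𝒳 → ℝ) (t : Fin K) (z : Fin n → Fin K × 𝒳)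
    (γ b : Coef p K) : fderiv ℝ (calLoss f t z) γ b = calDeriv f t z γ b :=
  ((differentiable_calLoss f t z γ).hasFDerivAt.hasLineDerivAt b).unique
    (hasLineDerivAt_calLoss f t z γ b)

theorem symBregman_eq (f : Fin (p + 1) → 𝒳 → ℝ) (t : Fin K) (z : Fin n → Fin K × 𝒳)
    (γ γ' : Coef p K) :
    symBregman f t z γ γ' = calDeriv f t z γ (γ - γ') - calDeriv f t z γ' (γ - γ') := by
  simp only [symBregman, bregman, fderiv_calLoss]
  rw [calDeriv_neg f t z γ γ' γ]
  ring

theorem symBregman_eq_sum (f : Fin (p + 1) → 𝒳 → ℝ) (t : Fin K) (z : Fin n → Fin K × 𝒳)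
    (γ γ' : Coef p K) :
    symBregman f t z γ γ' = (n : ℝ)⁻¹ * ∑ i, ∑ k ∈ Finset.univ.erase t,
      ind t (z i).1 * Real.exp (contrast f t γ' k (z i).2) *
        ((Real.exp (contrast f t (γ - γ') k (z i).2) - 1) * contrast f t (γ - γ') k (z i).2) := by
  rw [symBregman_eq, calDeriv, calDeriv, ← mul_sub, ← Finset.sum_sub_distrib]
  congr 1
  refine Finset.sum_congr rfl fun i _ => ?_
  rw [pointDeriv, pointDeriv, ← Finset.sum_sub_distrib]
  refine Finset.sum_congr rfl fun k _ => ?_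
  have : contrast f t γ k (z i).2 = contrast f t γ' k (z i).2
      + contrast f t (γ - γ') k (z i).2 := by
    rw [contrast_sub]; ring
  rw [this, Real.exp_add]
  ring

/-- The quotient `(exp d - 1) / d` is increasing, so on `[-c, c]` it is smallest at `-c`. For
negative `d` this is the chord bound for `exp` on `[-c, 0]`; for positive `d` the tangent bounds
suffice. -/
theorem one_sub_exp_neg_mul_sq_le {c d : ℝ} (hd : |d| ≤ c) :
    (1 - Real.exp (-c)) * d ^ 2 ≤ c * ((Real.exp d - 1) * d) := by
  have hc : 0 ≤ c := (abs_nonneg d).trans hd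
  rcases hc.eq_or_lt with rfl | hc'
  · simp
  rcases le_total 0 d with h | h
  · have h1 := Real.add_one_le_exp d
    have h2 := Real.add_one_le_exp (-c)
    calc _ ≤ c * d ^ 2 := by gcongr; linarith
      _ ≤ _ := by nlinarith [mul_nonneg hc (mul_nonneg (sub_nonneg.2 h1) h)]
  · have hd' := (abs_le.1 hd).1
    have hle : -d / c ≤ 1 := by rw [div_le_one hc']; linarith
    have hconv := convexOn_exp.2 (Set.mem_univ (-c)) (Set.mem_univ 0)
      (div_nonneg (neg_nonneg.2 h) hc) (sub_nonneg.2 hle) (by ring)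
    have he : (-d / c) • (-c) + (1 - -d / c) • (0 : ℝ) = d := by
      simp only [smul_eq_mul]; field_simp; ring
    rw [he] at hconv
    simp only [smul_eq_mul, Real.exp_zero, mul_one] at hconv
    have h3 : c * Real.exp d ≤ -d * Real.exp (-c) + (c + d) := by
      calc _ ≤ c * (-d / c * Real.exp (-c) + (1 - -d / c)) := by gcongr
        _ = _ := by field_simp; ring
    nlinarith

theorem one_sub_exp_neg_mul_sampleHess_le (f : Fin (p + 1) → 𝒳 → ℝ) (t : Fin K)
    (z : Fin n → Fin K × 𝒳) (γ γ' : Coef p K) {c : ℝ}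
    (hc : ∀ i k, |contrast f t (γ - γ') k (z i).2| ≤ c) :
    (1 - Real.exp (-c)) * sampleHess f t z γ' (γ - γ') ≤ c * symBregman f t z γ γ' := by
  rw [symBregman_eq_sum, sampleHess, mul_left_comm, mul_left_comm c]
  refine mul_le_mul_of_nonneg_left ?_ (by positivity)
  rw [Finset.mul_sum, Finset.mul_sum]
  refine Finset.sum_le_sum fun i _ => ?_
  rw [pointHess, Finset.mul_sum, Finset.mul_sum]
  refine Finset.sum_le_sum fun k _ => ?_
  rw [mul_left_comm, mul_left_comm c]
  refine mul_le_mul_of_nonneg_left (one_sub_exp_neg_mul_sq_le (hc i k)) ?_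
  exact mul_nonneg (ind_nonneg _ _) (Real.exp_pos _).le

theorem symBregman_nonneg (f : Fin (p + 1) → 𝒳 → ℝ) (t : Fin K) (z : Fin n → Fin K × 𝒳)
    (γ γ' : Coef p K) : 0 ≤ symBregman f t z γ γ' := by
  rw [symBregman_eq_sum]
  refine mul_nonneg (by positivity) (Finset.sum_nonneg fun i _ => Finset.sum_nonneg fun k _ =>
    mul_nonneg (mul_nonneg (ind_nonneg _ _) (Real.exp_pos _).le) ?_)
  rcases le_total 0 (contrast f t (γ - γ') k (z i).2) with h | h
  · exact mul_nonneg (sub_nonneg.2 (Real.one_le_exp h)) h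
  · exact mul_nonneg_of_nonpos_of_nonpos (sub_nonpos.2 (Real.exp_le_one_iff.2 h)) h

theorem convexOn_calLoss (f : Fin (p + 1) → 𝒳 → ℝ) (t : Fin K) (z : Fin n → Fin K × 𝒳) :
    ConvexOn ℝ Set.univ (calLoss f t z) := by
  refine ⟨convex_univ, fun γ _ γ' _ a b ha hb hab => ?_⟩
  simp only [calLoss, smul_eq_mul]
  rw [mul_left_comm a, mul_left_comm b, ← mul_add]
  refine mul_le_mul_of_nonneg_left ?_ (by positivity)
  rw [Finset.mul_sum, Finset.mul_sum, ← Finset.sum_add_distrib]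
  refine Finset.sum_le_sum fun i _ => ?_
  rw [pointLoss, pointLoss, pointLoss, Finset.mul_sum, Finset.mul_sum, ← Finset.sum_add_distrib]
  refine Finset.sum_le_sum fun k _ => ?_
  change ind t (z i).1 * Real.exp (contrast f t (a • γ + b • γ') k (z i).2)
    - ind k (z i).1 * contrast f t (a • γ + b • γ') k (z i).2 ≤
    a * (ind t (z i).1 * Real.exp (contrast f t γ k (z i).2)
      - ind k (z i).1 * contrast f t γ k (z i).2)
    + b * (ind t (z i).1 * Real.exp (contrast f t γ' k (z i).2)
      - ind k (z i).1 * contrast f t γ' k (z i).2)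
  rw [contrast_add, contrast_smul, contrast_smul]
  have := convexOn_exp.2 (Set.mem_univ (contrast f t γ k (z i).2))
    (Set.mem_univ (contrast f t γ' k (z i).2)) ha hb hab
  simp only [smul_eq_mul] at this
  nlinarith [mul_le_mul_of_nonneg_left this (ind_nonneg t (z i).1)]

theorem convexOn_penLoss (f : Fin (p + 1) → 𝒳 → ℝ) (t : Fin K) (z : Fin n → Fin K × 𝒳) {lam : ℝ}
    (hlam : 0 ≤ lam) : ConvexOn ℝ Set.univ (penLoss f t z lam) := by
  refine (convexOn_calLoss f t z).add ?_
  refine ConvexOn.smul hlam ⟨convex_univ, fun x _ y _ a b ha hb hab => ?_⟩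
  simp only [smul_eq_mul]
  rw [Finset.mul_sum, Finset.mul_sum, ← Finset.sum_add_distrib]
  exact Finset.sum_le_sum fun j _ => (convexOn_rowNorm j).2 (Set.mem_univ x) (Set.mem_univ y)
    ha hb hab

theorem continuous_penLoss (f : Fin (p + 1) → 𝒳 → ℝ) (t : Fin K) (z : Fin n → Fin K × 𝒳)
    (lam : ℝ) : Continuous (penLoss f t z lam) :=
  (differentiable_calLoss f t z).continuous.add
    (continuous_const.mul (continuous_finsetSum _ fun j _ => continuous_rowNorm j))

/-- Dividing the optimality inequality by `τ` and letting `τ` tend to zero differentiates the smooth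
part, while convexity handles the penalty. Only optimality on the segment is assumed, so that
minimizers over a ball centred at `γ'` are covered too. -/
theorem calDeriv_le_of_penLoss_le (f : Fin (p + 1) → 𝒳 → ℝ) (t : Fin K) (z : Fin n → Fin K × 𝒳)
    {lam : ℝ} (hlam : 0 ≤ lam) (γ γ' : Coef p K)
    (hopt : ∀ τ : ℝ, 0 ≤ τ → τ ≤ 1 →
      penLoss f t z lam γ ≤ penLoss f t z lam (γ + τ • (γ' - γ))) :
    calDeriv f t z γ (γ - γ') ≤ lam * ∑ j ∈ Finset.univ.erase (0 : Fin (p + 1)),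
      (rowNorm γ' j - rowNorm γ j) := by
  rw [calDeriv_neg, neg_le]
  have hd := (hasLineDerivAt_calLoss f t z γ (γ' - γ)).tendsto_slope_zero_right
  refine ge_of_tendsto hd ?_
  filter_upwards [Ioc_mem_nhdsGT (zero_lt_one' ℝ)] with τ hτ
  have h := hopt τ hτ.1.le hτ.2
  have hpen : ∑ j ∈ Finset.univ.erase (0 : Fin (p + 1)), rowNorm (γ + τ • (γ' - γ)) j
      ≤ ∑ j ∈ Finset.univ.erase (0 : Fin (p + 1)), rowNorm γ j
        + τ * ∑ j ∈ Finset.univ.erase (0 : Fin (p + 1)), (rowNorm γ' j - rowNorm γ j) := by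
    rw [Finset.mul_sum, ← Finset.sum_add_distrib]
    refine Finset.sum_le_sum fun j _ => ?_
    have := (convexOn_rowNorm (K := K) j).2 (Set.mem_univ γ) (Set.mem_univ γ')
      (sub_nonneg.2 hτ.2) hτ.1.le (by ring)
    have he : (1 - τ) • γ + τ • γ' = γ + τ • (γ' - γ) := by module
    rw [he] at this
    simp only [smul_eq_mul] at this
    linarith
  have hpen' := mul_le_mul_of_nonneg_left hpen hlam
  unfold penLoss at h
  rw [smul_eq_mul]
  rw [inv_mul_eq_div, le_div_iff₀ hτ.1]
  linarith

end

/-! ### The deterministic oracle inequality and existence of the estimate -/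

/-- The scalar inequalities behind the oracle bound. -/
theorem oracle_arith {D N s h q lt m κ B₀ ν ξ η₁ η₂ A : ℝ}
    (hD : 0 ≤ D) (hN : 0 ≤ N) (hlt : 0 < lt) (hm : 0 < m) (hκ : 0 ≤ κ) (hB₀ : 0 < B₀)
    (hν : 0 < ν) (hξ : 1 < ξ) (hη₁ : η₁ < 1) (hη₂0 : 0 < η₂) (hη₂ : η₂ < 1) (hA : 1 < A)
    (hsN : s ≤ N)
    (hX : D + (A - 1) * lt * N ≤ (ξ + 1) * (A - 1) * lt * s)
    (hcompat : ν ^ 2 * s ^ 2 ≤ m * h) (hhess : h ≤ q + κ * lt * N ^ 2)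
    (hq : (1 - Real.exp (-(2 * B₀ * N))) * q ≤ 2 * B₀ * N * D)
    (ha : (ξ + 1) ^ 2 * (ν ^ 2)⁻¹ * m * κ * lt ≤ η₁)
    (hb : 2 * B₀ * (ξ + 1) ^ 2 * (A - 1) * (1 - η₁)⁻¹ * (ν ^ 2)⁻¹ * m * lt ≤ η₂) :
    D + (A - 1) * lt * N ≤ ((ξ + 1) * (A - 1)) ^ 2
        * ((ν * Real.sqrt (1 - η₁) * Real.sqrt (1 - η₂)) ^ 2)⁻¹ * m * lt ^ 2
      ∧ 1 - Real.exp (-(2 * B₀ * N)) ≤ η₂ := by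
  have hη₁' : 0 < 1 - η₁ := by linarith
  have hη₂' : 0 < 1 - η₂ := by linarith
  have hA' : 0 < A - 1 := by linarith
  have hν2 : 0 < ν ^ 2 := by positivity
  rw [mul_pow (ν * _), mul_pow ν, Real.sq_sqrt hη₁'.le, Real.sq_sqrt hη₂'.le]
  have ha' : (ξ + 1) ^ 2 * m * κ * lt ≤ η₁ * ν ^ 2 := by
    calc _ = ((ξ + 1) ^ 2 * (ν ^ 2)⁻¹ * m * κ * lt) * ν ^ 2 := by field_simp
      _ ≤ _ := by gcongr
  have hb' : 2 * B₀ * (ξ + 1) ^ 2 * (A - 1) * m * lt ≤ η₂ * ((1 - η₁) * ν ^ 2) := by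
    calc _ = (2 * B₀ * (ξ + 1) ^ 2 * (A - 1) * (1 - η₁)⁻¹ * (ν ^ 2)⁻¹ * m * lt)
          * ((1 - η₁) * ν ^ 2) := by field_simp
      _ ≤ _ := by gcongr
  set X := D + (A - 1) * lt * N with hXdef
  have hX0 : 0 ≤ X := by positivity
  have hDX : D ≤ X := by rw [hXdef]; linarith [show 0 ≤ (A - 1) * lt * N by positivity]
  have hNX : (A - 1) * lt * N ≤ X := by rw [hXdef]; linarith
  have hNs : N ≤ (ξ + 1) * s := by
    have : (A - 1) * lt * N ≤ (A - 1) * lt * ((ξ + 1) * s) := by linarith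
    exact le_of_mul_le_mul_left this (by positivity)
  set c := 2 * B₀ * N with hc
  have hc0 : 0 ≤ c := by positivity
  set e := 1 - Real.exp (-c) with he
  have he0 : 0 ≤ e := sub_nonneg.2 (Real.exp_le_one_iff.2 (by linarith))
  -- Since `N ≤ (ξ + 1) * s`, the first smallness condition absorbs the Hessian error into a
  -- fraction `η₁` of the compatibility bound.
  have h1 : (1 - η₁) * ν ^ 2 * s ^ 2 ≤ m * q := by
    have h2 : m * (κ * lt * N ^ 2) ≤ η₁ * ν ^ 2 * s ^ 2 := by
      calc _ ≤ m * (κ * lt * ((ξ + 1) * s) ^ 2) := by gcongr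
        _ = ((ξ + 1) ^ 2 * m * κ * lt) * s ^ 2 := by ring
        _ ≤ _ := by gcongr
    linarith [mul_le_mul_of_nonneg_left hhess hm.le]
  have h3 : e * ((1 - η₁) * ν ^ 2 * s ^ 2) ≤ m * (c * X) := by
    calc _ ≤ e * (m * q) := by gcongr
      _ = m * (e * q) := by ring
      _ ≤ m * (c * D) := by gcongr
      _ ≤ _ := by gcongr
  have h4 : e * ((1 - η₁) * ν ^ 2) * X ^ 2 ≤ ((ξ + 1) * (A - 1)) ^ 2 * lt ^ 2 * m * c * X := by
    calc _ ≤ e * ((1 - η₁) * ν ^ 2) * ((ξ + 1) * (A - 1) * lt * s) ^ 2 := by gcongr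
      _ = ((ξ + 1) * (A - 1) * lt) ^ 2 * (e * ((1 - η₁) * ν ^ 2 * s ^ 2)) := by ring
      _ ≤ ((ξ + 1) * (A - 1) * lt) ^ 2 * (m * (c * X)) := by gcongr
      _ = _ := by ring
  rcases hX0.eq_or_lt with hX0' | hXpos
  · have hN0 : N = 0 := by
      have : (A - 1) * lt * N ≤ 0 := by linarith
      have h' : 0 < (A - 1) * lt := by positivity
      exact le_antisymm (le_of_mul_le_mul_left (by rwa [mul_zero]) h') hN
    refine ⟨by rw [← hX0']; positivity, ?_⟩
    rw [he, hc, hN0]; simp [hη₂0.le]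
  have h5 : e * ((1 - η₁) * ν ^ 2) * X ≤ ((ξ + 1) * (A - 1)) ^ 2 * lt ^ 2 * m * c := by
    refine le_of_mul_le_mul_right ?_ hXpos
    linarith
  -- Self-bounding step: `c` is a multiple of `N`, and `(A - 1) * lt * N ≤ X`, so `X` cancels and an
  -- absolute bound on `e` remains.
  have h6 : e * ((1 - η₁) * ν ^ 2) ≤ η₂ * ((1 - η₁) * ν ^ 2) := by
    refine le_trans ?_ hb'
    refine le_of_mul_le_mul_right ?_ hXpos
    calc _ ≤ ((ξ + 1) * (A - 1)) ^ 2 * lt ^ 2 * m * c := h5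
      _ = (2 * B₀ * (ξ + 1) ^ 2 * (A - 1) * m * lt) * ((A - 1) * lt * N) := by rw [hc]; ring
      _ ≤ _ := by gcongr
  have h7 : e ≤ η₂ := le_of_mul_le_mul_right h6 (by positivity)
  refine ⟨?_, h7⟩
  have hcpos : 0 < c := by
    refine hc0.lt_of_ne fun h0 => ?_
    have hN0 : N = 0 := by
      have : 2 * B₀ ≠ 0 := by positivity
      exact (mul_eq_zero.1 (hc ▸ h0.symm)).resolve_left this
    have : (ξ + 1) * (A - 1) * lt * s ≤ 0 := mul_nonpos_of_nonneg_of_nonpos (by positivity)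
      (hN0 ▸ hsN)
    linarith
  -- `e / c` is at least `exp (-c)`, which the bound on `e` keeps above `1 - η₂`; this lets `c`
  -- cancel from `h5`.
  have h8 : c * (1 - η₂) ≤ e := by
    have h9 : 1 - η₂ ≤ Real.exp (-c) := by linarith
    have h10 : c * Real.exp (-c) ≤ 1 - Real.exp (-c) := by
      have h11 := mul_le_mul_of_nonneg_right (Real.add_one_le_exp c) (Real.exp_pos (-c)).le
      rw [← Real.exp_add, add_neg_cancel, Real.exp_zero] at h11
      linarith
    calc _ ≤ c * Real.exp (-c) := by gcongr
      _ ≤ _ := h10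
  have h12 : X * (ν ^ 2 * (1 - η₁) * (1 - η₂)) ≤ ((ξ + 1) * (A - 1)) ^ 2 * m * lt ^ 2 := by
    refine le_of_mul_le_mul_right ?_ hcpos
    calc _ = (c * (1 - η₂)) * ((1 - η₁) * ν ^ 2) * X := by ring
      _ ≤ e * ((1 - η₁) * ν ^ 2) * X := by gcongr
      _ ≤ _ := h5
      _ = _ := by ring
  rw [← le_div_iff₀ (by positivity)] at h12
  refine h12.trans (le_of_eq ?_)
  field_simp

variable {p K n : ℕ} {𝒳 : Type*}

/-- The intercept is absent from the left side, but its index lies in `S`, so its norm may be added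
on the right. Off `S` the row of `γ'` vanishes and the difference is exactly minus the row norm. -/
theorem penalty_sub_le {γ γ' : Coef p K} {S : Finset (Fin (p + 1))} (h0 : 0 ∈ S)
    (hS : ∀ j ∉ S, γ' j = 0) :
    ∑ j ∈ Finset.univ.erase (0 : Fin (p + 1)), (rowNorm γ' j - rowNorm γ j)
      ≤ ∑ j ∈ S, rowNorm (γ - γ') j - ∑ j ∈ Sᶜ, rowNorm (γ - γ') j := by
  have hle : ∀ j, rowNorm γ' j - rowNorm γ j ≤ rowNorm (γ - γ') j := fun j => by
    have := rowNorm_add_le γ (γ' - γ) j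
    rw [add_sub_cancel, rowNorm_sub_comm] at this
    linarith
  have hsplit : ∑ j ∈ Finset.univ.erase (0 : Fin (p + 1)), (rowNorm γ' j - rowNorm γ j)
      = ∑ j ∈ S.erase 0, (rowNorm γ' j - rowNorm γ j) + ∑ j ∈ Sᶜ, (rowNorm γ' j - rowNorm γ j) := by
    rw [Finset.sum_erase_eq_sub (Finset.mem_univ 0), Finset.sum_erase_eq_sub h0,
      ← Finset.sum_add_sum_compl S]
    ring
  rw [hsplit, sub_eq_add_neg, ← Finset.sum_neg_distrib]
  refine add_le_add ?_ (Finset.sum_le_sum fun j hj => ?_)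
  · calc _ ≤ ∑ j ∈ S.erase 0, rowNorm (γ - γ') j := Finset.sum_le_sum fun j _ => hle j
      _ ≤ _ := Finset.sum_le_sum_of_subset_of_nonneg (Finset.erase_subset _ _)
        fun j _ _ => rowNorm_nonneg _ j
  · have hz := hS j (Finset.mem_compl.1 hj)
    have h1 : rowNorm γ' j = 0 := by simp [rowNorm, hz]
    have h2 : rowNorm (γ - γ') j = rowNorm γ j := by simp [rowNorm, hz]
    rw [h1, h2, zero_sub]

theorem apply_eq_zero_of_notMem_activeSet {γ : Coef p K} {j : Fin (p + 1)}
    (h : j ∉ activeSet γ) : γ j = 0 := by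
  simp only [activeSet, Finset.mem_filter_univ, not_or, not_not] at h
  exact h.2

theorem zero_mem_activeSet (γ : Coef p K) : 0 ∈ activeSet γ := by simp [activeSet]

section Oracle

variable [MeasurableSpace 𝒳] {f : Fin (p + 1) → 𝒳 → ℝ} {t : Fin K} {Q : Measure (Fin K × 𝒳)}
  {z : Fin n → Fin K × 𝒳} {γbar : Coef p K} {lt κ B₀ ν ξ η₁ η₂ A : ℝ}

theorem oracle_of_penLoss_le
    (hlt : 0 < lt) (hκ : 0 ≤ κ) (hB₀ : 0 < B₀)
    (hν : 0 < ν) (hξ : 1 < ξ) (hη₁ : η₁ < 1) (hη₂0 : 0 < η₂) (hη₂ : η₂ < 1)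
    (hA : (ξ + 1) / (ξ - 1) < A)
    (hf : ∀ i j, |f j (z i).2| ≤ B₀)
    (hgrad : ∀ b, SumToZero b → |calDeriv f t z γbar b| ≤ lt * norm21 b)
    (hhess : ∀ b, SumToZero b →
      hessForm f t Q γbar b ≤ sampleHess f t z γbar b + κ * lt * norm21 b ^ 2)
    (hcompat : Compatibility f t Q γbar (activeSet γbar) ν ξ)
    (ha : (ξ + 1) ^ 2 * (ν ^ 2)⁻¹ * ((activeSet γbar).card : ℝ) * κ * lt ≤ η₁)
    (hb : 2 * B₀ * (ξ + 1) ^ 2 * (A - 1) * (1 - η₁)⁻¹ * (ν ^ 2)⁻¹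
      * ((activeSet γbar).card : ℝ) * lt ≤ η₂)
    (hγbar : SumToZero γbar) {γ : Coef p K} (hγ : SumToZero γ)
    (hopt : ∀ τ : ℝ, 0 ≤ τ → τ ≤ 1 →
      penLoss f t z (A * lt) γ ≤ penLoss f t z (A * lt) (γ + τ • (γbar - γ))) :
    symBregman f t z γ γbar + (A - 1) * lt * norm21 (γ - γbar)
        ≤ ((ξ + 1) * (A - 1)) ^ 2 * ((ν * Real.sqrt (1 - η₁) * Real.sqrt (1 - η₂)) ^ 2)⁻¹
          * ((activeSet γbar).card : ℝ) * lt ^ 2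
      ∧ 1 - Real.exp (-(2 * B₀ * norm21 (γ - γbar))) ≤ η₂ := by
  have hξ' : 0 < ξ - 1 := by linarith
  have hA1 : ξ + 1 < A * (ξ - 1) := (div_lt_iff₀ hξ').1 hA
  have hA2 : 1 < A := by nlinarith
  have hsz := hγ.sub hγbar
  have hD := symBregman_nonneg f t z γ γbar
  have hfirst := calDeriv_le_of_penLoss_le f t z (by positivity) γ γbar hopt
  have hpen := penalty_sub_le (γ := γ) (zero_mem_activeSet γbar)
    fun j => apply_eq_zero_of_notMem_activeSet
  have hg := (abs_le.1 (hgrad _ hsz)).1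
  have hNsum : norm21 (γ - γbar) = ∑ j ∈ activeSet γbar, rowNorm (γ - γbar) j
      + ∑ j ∈ (activeSet γbar)ᶜ, rowNorm (γ - γbar) j := (Finset.sum_add_sum_compl _ _).symm
  have hDeq := symBregman_eq f t z γ γbar
  set s := ∑ j ∈ activeSet γbar, rowNorm (γ - γbar) j with hs
  set s' := ∑ j ∈ (activeSet γbar)ᶜ, rowNorm (γ - γbar) j with hs'
  have hs0 : 0 ≤ s := Finset.sum_nonneg fun j _ => rowNorm_nonneg _ j
  -- Optimality contributes `A * lt * (s - s')` and the score bound `lt * (s + s')`.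
  have hbasic : symBregman f t z γ γbar + (A - 1) * lt * s' ≤ (A + 1) * lt * s := by
    have := mul_le_mul_of_nonneg_left hpen (show 0 ≤ A * lt by positivity)
    rw [hNsum] at hg
    nlinarith
  -- The lower bound on `A` is equivalent to `A + 1 < ξ * (A - 1)`.
  have hslack : (A + 1) * lt * s ≤ ξ * ((A - 1) * lt * s) := by
    have : 0 ≤ lt * s := by positivity
    nlinarith
  have hcone : s' ≤ ξ * s := by
    have h : (A - 1) * lt * s' ≤ (A - 1) * lt * (ξ * s) := by linarith
    exact le_of_mul_le_mul_left h (mul_pos (by linarith) hlt)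
  refine oracle_arith (s := s) (h := hessForm f t Q γbar (γ - γbar))
    (q := sampleHess f t z γbar (γ - γbar)) hD (norm21_nonneg _) hlt
    (Nat.cast_pos.2 (Finset.card_pos.2 ⟨0, zero_mem_activeSet γbar⟩)) hκ hB₀ hν hξ hη₁ hη₂0 hη₂ hA2
    ?_ ?_ (hcompat _ hsz hcone) (hhess _ hsz) ?_ ha hb
  · rw [hNsum]
    exact le_add_of_nonneg_right (Finset.sum_nonneg fun j _ => rowNorm_nonneg _ j)
  · rw [hNsum]; linarith
  · exact one_sub_exp_neg_mul_sampleHess_le f t z γ γbar fun i k =>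
      abs_contrast_le f t _ k _ (hf i)

/-- No coercivity is needed, which matters because the intercepts are unpenalized. A minimizer over
a ball around `γbar` is optimal on the segment to the centre, so the a priori bound applies and
places it strictly inside; a local minimizer of a convex function is global. -/
theorem exists_isRCALEstimate
    (hlt : 0 < lt) (hκ : 0 ≤ κ) (hB₀ : 0 < B₀)
    (hν : 0 < ν) (hξ : 1 < ξ) (hη₁ : η₁ < 1) (hη₂0 : 0 < η₂) (hη₂ : η₂ < 1)
    (hA : (ξ + 1) / (ξ - 1) < A)
    (hf : ∀ i j, |f j (z i).2| ≤ B₀)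
    (hgrad : ∀ b, SumToZero b → |calDeriv f t z γbar b| ≤ lt * norm21 b)
    (hhess : ∀ b, SumToZero b →
      hessForm f t Q γbar b ≤ sampleHess f t z γbar b + κ * lt * norm21 b ^ 2)
    (hcompat : Compatibility f t Q γbar (activeSet γbar) ν ξ)
    (ha : (ξ + 1) ^ 2 * (ν ^ 2)⁻¹ * ((activeSet γbar).card : ℝ) * κ * lt ≤ η₁)
    (hb : 2 * B₀ * (ξ + 1) ^ 2 * (A - 1) * (1 - η₁)⁻¹ * (ν ^ 2)⁻¹
      * ((activeSet γbar).card : ℝ) * lt ≤ η₂)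
    (hγbar : SumToZero γbar) : ∃ γ, IsRCALEstimate f t z (A * lt) γ := by
  have hA0 : 0 ≤ A * lt := by
    have : 0 < (ξ + 1) / (ξ - 1) := div_pos (by linarith) (by linarith)
    exact mul_nonneg (by linarith) hlt.le
  -- The a priori bound is `-log (1 - η₂) / (2 * B₀)`; the extra `1` makes the radius strictly
  -- larger.
  set R := (1 - Real.log (1 - η₂)) / (2 * B₀) with hR
  have hlog : Real.log (1 - η₂) ≤ 0 := Real.log_nonpos (by linarith) (by linarith)
  have hR0 : 0 ≤ R := div_nonneg (by linarith) (by positivity)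
  set C : Set (Coef p K) := {γ | SumToZero γ} ∩ {γ | norm21 (γ - γbar) ≤ R} with hC
  have hcont : Continuous fun γ : Coef p K => norm21 (γ - γbar) :=
    continuous_norm21.comp (continuous_id.sub continuous_const)
  have hCc : IsCompact C := by
    refine Metric.isCompact_of_isClosed_isBounded
      (isClosed_sumToZero.inter (isClosed_le hcont continuous_const)) ?_
    refine (Metric.isBounded_closedBall (x := γbar) (r := R)).subset fun γ hγ => ?_
    rw [Metric.mem_closedBall, dist_eq_norm]
    exact (norm_le_norm21 _).trans hγ.2
  have hne : C.Nonempty := ⟨γbar, hγbar, by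
    have : norm21 (γbar - γbar) = 0 := by
      rw [sub_self, ← zero_smul ℝ (0 : Coef p K), norm21_smul, abs_zero, zero_mul]
    rw [Set.mem_ofPred_eq, this]; exact hR0⟩
  obtain ⟨γ, hγC, hmin⟩ := hCc.exists_isMinOn hne (continuous_penLoss f t z (A * lt)).continuousOn
  have hopt : ∀ τ : ℝ, 0 ≤ τ → τ ≤ 1 →
      penLoss f t z (A * lt) γ ≤ penLoss f t z (A * lt) (γ + τ • (γbar - γ)) := by
    refine fun τ h0 h1 => hmin ⟨hγC.1.add ((hγbar.sub hγC.1).smul τ), ?_⟩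
    have he : γ + τ • (γbar - γ) - γbar = (1 - τ) • (γ - γbar) := by module
    simp only [Set.mem_ofPred_eq, he, norm21_smul, abs_of_nonneg (sub_nonneg.2 h1)]
    have := norm21_nonneg (γ - γbar)
    have h2 : norm21 (γ - γbar) ≤ R := hγC.2
    nlinarith
  have hlt' := (oracle_of_penLoss_le hlt hκ hB₀ hν hξ hη₁ hη₂0 hη₂ hA hf hgrad hhess hcompat ha hb
    hγbar hγC.1 hopt).2
  have hint : norm21 (γ - γbar) < R := by
    have h1 : 1 - η₂ ≤ Real.exp (-(2 * B₀ * norm21 (γ - γbar))) := by linarith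
    have h2 := (Real.log_le_iff_le_exp (by linarith)).2 h1
    rw [hR, lt_div_iff₀ (by positivity)]
    linarith
  refine ⟨γ, hγC.1, fun γ' hγ' => ?_⟩
  refine IsMinOn.of_isLocalMinOn_of_convexOn (s := {γ : Coef p K | SumToZero γ})
    (f := penLoss f t z (A * lt)) hγC.1 ?_
    ((convexOn_penLoss f t z hA0).subset (Set.subset_univ _) convex_sumToZero) hγ'
  have hnear : ∀ᶠ γ' in nhdsWithin γ {γ : Coef p K | SumToZero γ}, norm21 (γ' - γbar) < R :=
    nhdsWithin_le_nhds (hcont.continuousAt.eventually_lt continuousAt_const hint)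
  filter_upwards [hnear, self_mem_nhdsWithin] with γ' h1 h2
  exact hmin ⟨h2, h1.le⟩

theorem IsRCALEstimate.oracle_inequality
    (hlt : 0 < lt) (hκ : 0 ≤ κ) (hB₀ : 0 < B₀)
    (hν : 0 < ν) (hξ : 1 < ξ) (hη₁ : η₁ < 1) (hη₂0 : 0 < η₂) (hη₂ : η₂ < 1)
    (hA : (ξ + 1) / (ξ - 1) < A)
    (hf : ∀ i j, |f j (z i).2| ≤ B₀)
    (hgrad : ∀ b, SumToZero b → |calDeriv f t z γbar b| ≤ lt * norm21 b)
    (hhess : ∀ b, SumToZero b →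
      hessForm f t Q γbar b ≤ sampleHess f t z γbar b + κ * lt * norm21 b ^ 2)
    (hcompat : Compatibility f t Q γbar (activeSet γbar) ν ξ)
    (ha : (ξ + 1) ^ 2 * (ν ^ 2)⁻¹ * ((activeSet γbar).card : ℝ) * κ * lt ≤ η₁)
    (hb : 2 * B₀ * (ξ + 1) ^ 2 * (A - 1) * (1 - η₁)⁻¹ * (ν ^ 2)⁻¹
      * ((activeSet γbar).card : ℝ) * lt ≤ η₂)
    (hγbar : SumToZero γbar) {γ : Coef p K} (hγ : IsRCALEstimate f t z (A * lt) γ) :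
    symBregman f t z γ γbar + (A - 1) * lt * norm21 (γ - γbar)
        ≤ ((ξ + 1) * (A - 1)) ^ 2 * ((ν * Real.sqrt (1 - η₁) * Real.sqrt (1 - η₂)) ^ 2)⁻¹
          * ((activeSet γbar).card : ℝ) * lt ^ 2 :=
  (oracle_of_penLoss_le hlt hκ hB₀ hν hξ hη₁ hη₂0 hη₂ hA hf hgrad hhess hcompat ha hb hγbar hγ.1
    fun τ _ _ => hγ.2 _ (hγ.1.add ((hγbar.sub hγ.1).smul τ))).1

end Oracle

/-! ### Algebra of the propensity, the Hessian and the score -/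

noncomputable section

variable {p K n : ℕ} {𝒳 : Type*}

theorem sum_ind (l : Fin K) : ∑ k, ind k l = 1 := by simp [ind]

theorem sum_erase_ind (t l : Fin K) : ∑ k ∈ Finset.univ.erase t, ind k l = 1 - ind t l := by
  rw [Finset.sum_erase_eq_sub (Finset.mem_univ t), sum_ind]

theorem propensity_pos [Nonempty (Fin K)] (f : Fin (p + 1) → 𝒳 → ℝ) (k : Fin K) (x : 𝒳)
    (γ : Coef p K) : 0 < propensity f k x γ :=
  div_pos (Real.exp_pos _) (Finset.sum_pos (fun _ _ => Real.exp_pos _) Finset.univ_nonempty)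

theorem propensity_eq_mul_exp_contrast (f : Fin (p + 1) → 𝒳 → ℝ) (t k : Fin K) (x : 𝒳)
    (γ : Coef p K) : propensity f k x γ = propensity f t x γ * Real.exp (contrast f t γ k x) := by
  rw [propensity, propensity, contrast, Real.exp_sub]
  have := (Real.exp_pos (lin f γ t x)).ne'
  field_simp

theorem sum_propensity [Nonempty (Fin K)] (f : Fin (p + 1) → 𝒳 → ℝ) (x : 𝒳) (γ : Coef p K) :
    ∑ k, propensity f k x γ = 1 := by
  simp only [propensity, ← Finset.sum_div]
  exact div_self (Finset.sum_pos (fun _ _ => Real.exp_pos _) Finset.univ_nonempty).ne'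

theorem inv_propensity [Nonempty (Fin K)] (f : Fin (p + 1) → 𝒳 → ℝ) (t : Fin K) (x : 𝒳)
    (γ : Coef p K) : (propensity f t x γ)⁻¹
      = 1 + ∑ k ∈ Finset.univ.erase t, Real.exp (contrast f t γ k x) := by
  have h := sum_propensity f x γ
  rw [Finset.sum_congr rfl fun k _ => propensity_eq_mul_exp_contrast f t k x γ] at h
  rw [← Finset.mul_sum, ← Finset.add_sum_erase _ _ (Finset.mem_univ t)] at h
  have h0 : contrast f t γ t x = 0 := sub_self _
  rw [h0, Real.exp_zero] at h
  exact inv_eq_of_mul_eq_one_right h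

/-- The matrix is the weighted Laplacian of the star graph centred at `t`, with weight `propensity f
k x γ` on the edge from `k` to `t`. -/
theorem dotProduct_hessMat_mulVec [Nonempty (Fin K)] (f : Fin (p + 1) → 𝒳 → ℝ) (t : Fin K) (x : 𝒳)
    (γ : Coef p K) (v : Fin K → ℝ) :
    v ⬝ᵥ Matrix.mulVec (hessMat f t x γ) v
      = ∑ k ∈ Finset.univ.erase t, propensity f k x γ * (v k - v t) ^ 2 := by
  have hne : ∀ k ∈ Finset.univ.erase t, Matrix.mulVec (hessMat f t x γ) v k
      = propensity f k x γ * (v k - v t) := fun k hk => by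
    have hk' := Finset.ne_of_mem_erase hk
    have : ∀ l, hessMat f t x γ k l
        = (if k = l then propensity f k x γ else 0) + (if t = l then -propensity f k x γ else 0) := by
      intro l
      simp only [hessMat, Matrix.of_apply, hk', if_false, eq_comm (a := t)]
      split_ifs with h1 h2 h2
      · exact absurd (h1.trans h2) hk'
      all_goals ring
    simp only [Matrix.mulVec, dotProduct, this, add_mul, Finset.sum_add_distrib, ite_mul, zero_mul,
      Finset.sum_ite_eq, Finset.mem_univ, if_true]
    ring
  have ht : Matrix.mulVec (hessMat f t x γ) v t
      = ∑ k ∈ Finset.univ.erase t, propensity f k x γ * (v t - v k) := by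
    rw [Matrix.mulVec, dotProduct, ← Finset.add_sum_erase _ _ (Finset.mem_univ t)]
    have h1 : hessMat f t x γ t t = ∑ k ∈ Finset.univ.erase t, propensity f k x γ := by
      simp only [hessMat, Matrix.of_apply, if_true]
      rw [← sum_propensity f x γ, Finset.sum_erase_eq_sub (Finset.mem_univ t)]
    rw [h1, Finset.sum_mul, ← Finset.sum_add_distrib]
    refine Finset.sum_congr rfl fun k hk => ?_
    have hk' := (Finset.ne_of_mem_erase hk).symm
    simp only [hessMat, Matrix.of_apply, hk', if_false, if_true]
    ring
  rw [dotProduct, ← Finset.add_sum_erase _ _ (Finset.mem_univ t), ht, Finset.mul_sum,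
    ← Finset.sum_add_distrib]
  refine Finset.sum_congr rfl fun k hk => ?_
  rw [hne k hk]
  ring

theorem hessForm_eq_integral [Nonempty (Fin K)] [MeasurableSpace 𝒳] (f : Fin (p + 1) → 𝒳 → ℝ)
    (t : Fin K) (Q : Measure (Fin K × 𝒳)) (γ b : Coef p K) :
    hessForm f t Q γ b = ∫ z, pointHess f t γ b z ∂Q := by
  refine integral_congr_ae (Filter.Eventually.of_forall fun z => ?_)
  simp only [dotProduct_hessMat_mulVec, pointHess, Finset.mul_sum]
  refine Finset.sum_congr rfl fun k _ => ?_
  rw [propensity_eq_mul_exp_contrast f t k z.2 γ, contrast]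
  have := (propensity_pos f t z.2 γ).ne'
  simp only [contrast]
  field_simp

/-- The derivative of the loss of one observation with respect to the linear predictors. -/
def score (f : Fin (p + 1) → 𝒳 → ℝ) (t : Fin K) (γ : Coef p K) (z : Fin K × 𝒳) (k : Fin K) : ℝ :=
  if k = t then
    -∑ l ∈ Finset.univ.erase t, (ind t z.1 * Real.exp (contrast f t γ l z.2) - ind l z.1)
  else ind t z.1 * Real.exp (contrast f t γ k z.2) - ind k z.1

/-- The gradient of the loss of one observation with respect to the row `γ_{j·}`. -/
def rowGrad (f : Fin (p + 1) → 𝒳 → ℝ) (t : Fin K) (γ : Coef p K) (j : Fin (p + 1))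
    (z : Fin K × 𝒳) : EuclideanSpace ℝ (Fin K) :=
  f j z.2 • WithLp.toLp 2 (score f t γ z)

theorem sum_score_mul (f : Fin (p + 1) → 𝒳 → ℝ) (t : Fin K) (γ : Coef p K) (z : Fin K × 𝒳)
    (v : Fin K → ℝ) : ∑ k, score f t γ z k * v k = ∑ k ∈ Finset.univ.erase t,
      (ind t z.1 * Real.exp (contrast f t γ k z.2) - ind k z.1) * (v k - v t) := by
  rw [← Finset.add_sum_erase _ _ (Finset.mem_univ t)]
  simp only [score, if_true, neg_mul, Finset.sum_mul]
  rw [← Finset.sum_neg_distrib, ← Finset.sum_add_distrib]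
  refine Finset.sum_congr rfl fun k hk => ?_
  rw [if_neg (Finset.ne_of_mem_erase hk)]
  ring

theorem sum_score (f : Fin (p + 1) → 𝒳 → ℝ) (t : Fin K) (γ : Coef p K) (z : Fin K × 𝒳) :
    ∑ k, score f t γ z k = 0 := by
  simpa using sum_score_mul f t γ z fun _ => 1

theorem pointDeriv_eq_sum_score (f : Fin (p + 1) → 𝒳 → ℝ) (t : Fin K) (γ b : Coef p K)
    (z : Fin K × 𝒳) : pointDeriv f t γ b z = ∑ k, score f t γ z k * lin f b k z.2 :=
  (sum_score_mul f t γ z _).symm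

theorem pointDeriv_eq_sum_inner (f : Fin (p + 1) → 𝒳 → ℝ) (t : Fin K) (γ b : Coef p K)
    (z : Fin K × 𝒳) :
    pointDeriv f t γ b z = ∑ j, inner ℝ (WithLp.toLp 2 (b j)) (rowGrad f t γ j z) := by
  rw [pointDeriv_eq_sum_score]
  simp only [rowGrad, PiLp.inner_apply, lin, Finset.mul_sum, RCLike.inner_apply, conj_trivial,
    PiLp.smul_apply, smul_eq_mul]
  rw [Finset.sum_comm]
  exact Finset.sum_congr rfl fun j _ => Finset.sum_congr rfl fun k _ => by ring

/-- Duality between the sum and the maximum of row norms reduces control in all directions to `p +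
1` vector events. -/
theorem abs_calDeriv_le (f : Fin (p + 1) → 𝒳 → ℝ) (t : Fin K) (z : Fin n → Fin K × 𝒳)
    (γ b : Coef p K) {r : ℝ} (hn : 1 ≤ n) (h : ∀ j, ‖∑ i, rowGrad f t γ j (z i)‖ ≤ n * r) :
    |calDeriv f t z γ b| ≤ r * norm21 b := by
  have hn' : (0 : ℝ) < n := by exact_mod_cast hn
  rw [calDeriv, abs_mul, abs_inv, Nat.abs_cast, inv_mul_le_iff₀ hn']
  simp only [pointDeriv_eq_sum_inner]
  rw [Finset.sum_comm, norm21, Finset.mul_sum, Finset.mul_sum]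
  refine (Finset.abs_sum_le_sum_abs _ _).trans (Finset.sum_le_sum fun j _ => ?_)
  rw [← inner_sum]
  calc _ ≤ rowNorm b j * ‖∑ i, rowGrad f t γ j (z i)‖ := abs_real_inner_le_norm _ _
    _ ≤ rowNorm b j * (n * r) := by have := rowNorm_nonneg b j; have := h j; gcongr
    _ = _ := by ring

/-- The entries with `k ≠ t` have absolute sum at most `B₁`, and entry `t` is minus their sum. Each
of the two parts has squared Euclidean norm at most `B₁ ^ 2`, whence `√2` and no dependence on `K`.
-/
theorem norm_rowGrad_le (f : Fin (p + 1) → 𝒳 → ℝ) (t : Fin K) (γ : Coef p K) (j : Fin (p + 1))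
    (z : Fin K × 𝒳) {B₀ B₁ : ℝ} (hf : |f j z.2| ≤ B₀) (hB₁ : 1 ≤ B₁)
    (hw : 1 + ∑ k ∈ Finset.univ.erase t, Real.exp (contrast f t γ k z.2) ≤ B₁) :
    ‖rowGrad f t γ j z‖ ≤ Real.sqrt 2 * (B₀ * B₁) := by
  set a : Fin K → ℝ := fun k => ind t z.1 * Real.exp (contrast f t γ k z.2) - ind k z.1 with ha
  have hsum : ∑ k ∈ Finset.univ.erase t, |a k| ≤ B₁ := by
    calc _ ≤ ∑ k ∈ Finset.univ.erase t,
          (ind t z.1 * Real.exp (contrast f t γ k z.2) + ind k z.1) :=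
          Finset.sum_le_sum fun k _ => by
            refine (abs_sub _ _).trans (le_of_eq ?_)
            rw [abs_of_nonneg (mul_nonneg (ind_nonneg _ _) (Real.exp_pos _).le),
              abs_of_nonneg (ind_nonneg _ _)]
      _ = ind t z.1 * ∑ k ∈ Finset.univ.erase t, Real.exp (contrast f t γ k z.2)
          + (1 - ind t z.1) := by rw [Finset.sum_add_distrib, sum_erase_ind, Finset.mul_sum]
      _ ≤ ind t z.1 * (B₁ - 1) + (1 - ind t z.1) := by
          have := ind_nonneg t z.1
          gcongr
          linarith
      _ ≤ B₁ := by nlinarith [ind_le_one t z.1, ind_nonneg t z.1]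
  have hsq : ‖WithLp.toLp 2 (score f t γ z)‖ ^ 2 ≤ 2 * B₁ ^ 2 := by
    rw [EuclideanSpace.norm_sq_eq, ← Finset.add_sum_erase _ _ (Finset.mem_univ t)]
    have h1 : ‖(WithLp.toLp 2 (score f t γ z)) t‖ ^ 2 ≤ B₁ ^ 2 := by
      simp only [score, if_true, norm_neg, Real.norm_eq_abs]
      have := (Finset.abs_sum_le_sum_abs a (Finset.univ.erase t)).trans hsum
      gcongr
    have h2 : ∑ k ∈ Finset.univ.erase t, ‖(WithLp.toLp 2 (score f t γ z)) k‖ ^ 2 ≤ B₁ ^ 2 := by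
      calc _ = ∑ k ∈ Finset.univ.erase t, |a k| ^ 2 := Finset.sum_congr rfl fun k hk => by
            simp only [score, if_neg (Finset.ne_of_mem_erase hk), Real.norm_eq_abs, ha]
        _ ≤ (∑ k ∈ Finset.univ.erase t, |a k|) ^ 2 :=
            Finset.sum_sq_le_sq_sum_of_nonneg fun k _ => abs_nonneg _
        _ ≤ _ := by
            have : 0 ≤ ∑ k ∈ Finset.univ.erase t, |a k| := Finset.sum_nonneg fun k _ => abs_nonneg _
            gcongr
    linarith
  have hnorm : ‖WithLp.toLp 2 (score f t γ z)‖ ≤ Real.sqrt 2 * B₁ := by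
    rw [← Real.sqrt_sq (show 0 ≤ B₁ by linarith), ← Real.sqrt_mul (by norm_num)]
    exact Real.le_sqrt_of_sq_le hsq
  rw [rowGrad, norm_smul, Real.norm_eq_abs]
  calc _ ≤ B₀ * (Real.sqrt 2 * B₁) := by
        have := (abs_nonneg _).trans hf
        gcongr
    _ = _ := by ring

/-- The weight of `(b_{jk} - b_{jt}) (b_{j'k} - b_{j't})` in the second derivative of the loss. -/
def hessWeight (f : Fin (p + 1) → 𝒳 → ℝ) (t : Fin K) (γ : Coef p K)
    (m : (Fin (p + 1) × Fin (p + 1)) × Fin K) (z : Fin K × 𝒳) : ℝ :=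
  ind t z.1 * Real.exp (contrast f t γ m.2 z.2) * (f m.1.1 z.2 * f m.1.2 z.2)

theorem pointHess_eq_sum (f : Fin (p + 1) → 𝒳 → ℝ) (t : Fin K) (γ b : Coef p K) (z : Fin K × 𝒳) :
    pointHess f t γ b z = ∑ k ∈ Finset.univ.erase t, ∑ j, ∑ j',
      hessWeight f t γ ((j, j'), k) z * ((b j k - b j t) * (b j' k - b j' t)) := by
  refine Finset.sum_congr rfl fun k _ => ?_
  rw [contrast_eq_sum f t b, sq, Finset.sum_mul_sum, Finset.mul_sum]
  refine Finset.sum_congr rfl fun j _ => ?_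
  rw [Finset.mul_sum]
  exact Finset.sum_congr rfl fun j' _ => by simp only [hessWeight]; ring

theorem abs_hessWeight_le (f : Fin (p + 1) → 𝒳 → ℝ) (t : Fin K) (γ : Coef p K)
    {m : (Fin (p + 1) × Fin (p + 1)) × Fin K} (hm : m.2 ≠ t) (z : Fin K × 𝒳) {B₀ B₁ : ℝ}
    (hf : ∀ j, |f j z.2| ≤ B₀)
    (hw : 1 + ∑ k ∈ Finset.univ.erase t, Real.exp (contrast f t γ k z.2) ≤ B₁) :
    |hessWeight f t γ m z| ≤ B₀ ^ 2 * B₁ := by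
  have hB₀ := (abs_nonneg _).trans (hf 0)
  have h1 : Real.exp (contrast f t γ m.2 z.2) ≤ B₁ := by
    have := Finset.single_le_sum (f := fun k => Real.exp (contrast f t γ k z.2))
      (fun k _ => (Real.exp_pos _).le) (Finset.mem_erase.2 ⟨hm, Finset.mem_univ _⟩)
    linarith
  have h2 : ind t z.1 * Real.exp (contrast f t γ m.2 z.2) ≤ 1 * B₁ := by
    have := ind_le_one t z.1
    gcongr
  rw [hessWeight, abs_mul, abs_mul (f _ _),
    abs_of_nonneg (mul_nonneg (ind_nonneg _ _) (Real.exp_pos _).le)]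
  have h3 := hf m.1.1
  have h4 := hf m.1.2
  have h5 := (Real.exp_pos (contrast f t γ m.2 z.2)).le.trans h1
  calc _ ≤ (1 * B₁) * (B₀ * B₀) := by gcongr
    _ = _ := by ring

/-- Under the constraint the left side is `rowNorm b j ^ 2 + K * b j t ^ 2`; Cauchy–Schwarz for `b j
t` as minus the sum of the other entries gives `K * b j t ^ 2 ≤ (K - 1) * rowNorm b j ^ 2`. -/
theorem sum_sub_sq_le {b : Coef p K} (hb : SumToZero b) (t : Fin K) (j : Fin (p + 1)) :
    ∑ k ∈ Finset.univ.erase t, (b j k - b j t) ^ 2 ≤ K * rowNorm b j ^ 2 := by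
  rw [rowNorm_sq]
  have h1 : ∑ k ∈ Finset.univ.erase t, (b j k - b j t) ^ 2
      = ∑ k, b j k ^ 2 + K * b j t ^ 2 := by
    rw [Finset.sum_erase _ (by simp)]
    simp only [sub_sq, Finset.sum_add_distrib, Finset.sum_sub_distrib, Finset.sum_const,
      Finset.card_univ, Fintype.card_fin, nsmul_eq_mul, ← Finset.mul_sum, ← Finset.sum_mul, hb j]
    ring
  have h2 := sq_sum_le_card_mul_sum_sq (s := Finset.univ.erase t) (f := b j)
  rw [Finset.sum_erase_eq_sub (Finset.mem_univ t), Finset.sum_erase_eq_sub (Finset.mem_univ t),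
    hb j, Finset.card_erase_of_mem (Finset.mem_univ t), Finset.card_univ, Fintype.card_fin,
    Nat.cast_sub t.pos] at h2
  push_cast at h2
  rw [h1]
  linarith

/-- Both forms are bilinear in the contrasts of `b`, so uniform control of the weights suffices;
Cauchy–Schwarz over `k` with `sum_sub_sq_le` produces the factor `K`. -/
theorem hessForm_le [Nonempty (Fin K)] [MeasurableSpace 𝒳] (f : Fin (p + 1) → 𝒳 → ℝ) (t : Fin K)
    (Q : Measure (Fin K × 𝒳)) (z : Fin n → Fin K × 𝒳) (γ b : Coef p K) (hb : SumToZero b)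
    (hint : ∀ m : (Fin (p + 1) × Fin (p + 1)) × Fin K, m.2 ≠ t →
      Integrable (hessWeight f t γ m) Q) {r : ℝ} (hr : 0 ≤ r) (hn : 1 ≤ n)
    (h : ∀ m : (Fin (p + 1) × Fin (p + 1)) × Fin K, m.2 ≠ t →
      |∑ i, (hessWeight f t γ m (z i) - ∫ y, hessWeight f t γ m y ∂Q)| ≤ n * r) :
    hessForm f t Q γ b ≤ sampleHess f t z γ b + r * K * norm21 b ^ 2 := by
  have hn' : (0 : ℝ) < n := by exact_mod_cast hn
  set I := fun m => ∫ y, hessWeight f t γ m y ∂Q with hI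
  have h1 : hessForm f t Q γ b = ∑ k ∈ Finset.univ.erase t, ∑ j, ∑ j',
      I ((j, j'), k) * ((b j k - b j t) * (b j' k - b j' t)) := by
    rw [hessForm_eq_integral]
    simp only [pointHess_eq_sum]
    have hi : ∀ k ∈ Finset.univ.erase t, ∀ j j', Integrable (fun z =>
        hessWeight f t γ ((j, j'), k) z * ((b j k - b j t) * (b j' k - b j' t))) Q :=
      fun k hk j j' => (hint _ (Finset.ne_of_mem_erase hk)).mul_const _
    rw [integral_finsetSum _ fun k hk => integrable_finsetSum _ fun j _ =>
      integrable_finsetSum _ fun j' _ => hi k hk j j']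
    refine Finset.sum_congr rfl fun k hk => ?_
    rw [integral_finsetSum _ fun j _ => integrable_finsetSum _ fun j' _ => hi k hk j j']
    refine Finset.sum_congr rfl fun j _ => ?_
    rw [integral_finsetSum _ fun j' _ => hi k hk j j']
    exact Finset.sum_congr rfl fun j' _ => integral_mul_const _ _
  have h2 : sampleHess f t z γ b = ∑ k ∈ Finset.univ.erase t, ∑ j, ∑ j',
      ((n : ℝ)⁻¹ * ∑ i, hessWeight f t γ ((j, j'), k) (z i))
        * ((b j k - b j t) * (b j' k - b j' t)) := by
    simp only [sampleHess, pointHess_eq_sum]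
    rw [Finset.sum_comm, Finset.mul_sum]
    refine Finset.sum_congr rfl fun k _ => ?_
    rw [Finset.sum_comm, Finset.mul_sum]
    refine Finset.sum_congr rfl fun j _ => ?_
    rw [Finset.sum_comm, Finset.mul_sum]
    refine Finset.sum_congr rfl fun j' _ => ?_
    rw [← Finset.sum_mul, mul_assoc]
  have h3 : ∀ m : (Fin (p + 1) × Fin (p + 1)) × Fin K, m.2 ≠ t →
      |I m - (n : ℝ)⁻¹ * ∑ i, hessWeight f t γ m (z i)| ≤ r := fun m hm => by
    have := h m hm
    rw [Finset.sum_sub_distrib, Finset.sum_const, Finset.card_univ, Fintype.card_fin,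
      nsmul_eq_mul] at this
    rw [abs_sub_comm, ← mul_le_mul_iff_right₀ hn', ← abs_of_pos hn', ← abs_mul, abs_of_pos hn']
    rwa [mul_sub, mul_inv_cancel_left₀ hn'.ne']
  have h4 : hessForm f t Q γ b - sampleHess f t z γ b ≤ ∑ k ∈ Finset.univ.erase t, ∑ j, ∑ j',
      r * (|b j k - b j t| * |b j' k - b j' t|) := by
    rw [h1, h2, ← Finset.sum_sub_distrib]
    refine Finset.sum_le_sum fun k hk => ?_
    rw [← Finset.sum_sub_distrib]
    refine Finset.sum_le_sum fun j _ => ?_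
    rw [← Finset.sum_sub_distrib]
    refine Finset.sum_le_sum fun j' _ => ?_
    rw [← sub_mul]
    refine (le_abs_self _).trans ?_
    rw [abs_mul, abs_mul (b j k - _)]
    have := h3 ((j, j'), k) (Finset.ne_of_mem_erase hk)
    gcongr
  have h5 : ∀ j j', ∑ k ∈ Finset.univ.erase t, |b j k - b j t| * |b j' k - b j' t|
      ≤ K * (rowNorm b j * rowNorm b j') := fun j j' => by
    have hs : ∀ j, Real.sqrt (∑ k ∈ Finset.univ.erase t, |b j k - b j t| ^ 2)
        ≤ Real.sqrt K * rowNorm b j := fun j => by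
      rw [← Real.sqrt_sq (rowNorm_nonneg b j), ← Real.sqrt_mul (Nat.cast_nonneg K)]
      refine Real.sqrt_le_sqrt ?_
      simp only [sq_abs]
      exact sum_sub_sq_le hb t j
    calc _ ≤ Real.sqrt (∑ k ∈ Finset.univ.erase t, |b j k - b j t| ^ 2)
          * Real.sqrt (∑ k ∈ Finset.univ.erase t, |b j' k - b j' t| ^ 2) :=
          Real.sum_mul_le_sqrt_mul_sqrt _ _ _
      _ ≤ (Real.sqrt K * rowNorm b j) * (Real.sqrt K * rowNorm b j') :=
          mul_le_mul (hs j) (hs j') (Real.sqrt_nonneg _)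
            (mul_nonneg (Real.sqrt_nonneg _) (rowNorm_nonneg _ _))
      _ = (Real.sqrt K * Real.sqrt K) * (rowNorm b j * rowNorm b j') := by ring
      _ = _ := by rw [Real.mul_self_sqrt (Nat.cast_nonneg K)]
  have h6 : ∑ k ∈ Finset.univ.erase t, ∑ j, ∑ j', r * (|b j k - b j t| * |b j' k - b j' t|)
      ≤ r * K * norm21 b ^ 2 := by
    rw [Finset.sum_comm, norm21, sq, Finset.sum_mul_sum, Finset.mul_sum]
    refine Finset.sum_le_sum fun j _ => ?_
    rw [Finset.sum_comm, Finset.mul_sum]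
    refine Finset.sum_le_sum fun j' _ => ?_
    rw [← Finset.mul_sum, mul_assoc]
    exact mul_le_mul_of_nonneg_left (h5 j j') hr
  linarith

end

/-! ### Integrability and the population first-order condition -/

section Population

variable {p K : ℕ} {𝒳 : Type*} [MeasurableSpace 𝒳] {f : Fin (p + 1) → 𝒳 → ℝ}

theorem measurable_ind_fst (k : Fin K) : Measurable fun z : Fin K × 𝒳 => ind k z.1 :=
  (measurable_of_finite (ind k)).comp measurable_fst

theorem measurable_contrast_snd (hf : ∀ j, Measurable (f j)) (t : Fin K) (γ : Coef p K)
    (k : Fin K) : Measurable fun z : Fin K × 𝒳 => contrast f t γ k z.2 := by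
  simp only [contrast_eq_sum]
  exact Finset.measurable_fun_sum _ fun j _ => ((hf j).comp measurable_snd).const_mul _

theorem measurable_score (hf : ∀ j, Measurable (f j)) (t : Fin K) (γ : Coef p K) (k : Fin K) :
    Measurable fun z => score f t γ z k := by
  have h : ∀ l, Measurable fun z : Fin K × 𝒳 =>
      ind t z.1 * Real.exp (contrast f t γ l z.2) - ind l z.1 := fun l =>
    ((measurable_ind_fst t).mul (measurable_contrast_snd hf t γ l).exp).sub (measurable_ind_fst l)
  unfold score
  split_ifs
  · exact (Finset.measurable_fun_sum _ fun l _ => h l).neg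
  · exact h k

theorem measurable_rowGrad (hf : ∀ j, Measurable (f j)) (t : Fin K) (γ : Coef p K)
    (j : Fin (p + 1)) : Measurable (rowGrad f t γ j) := by
  refine ((hf j).comp measurable_snd).smul ?_
  exact (WithLp.measurable_toLp 2 _).comp
    (measurable_pi_lambda _ fun k => measurable_score hf t γ k)

theorem measurable_hessWeight (hf : ∀ j, Measurable (f j)) (t : Fin K) (γ : Coef p K)
    (m : (Fin (p + 1) × Fin (p + 1)) × Fin K) : Measurable (hessWeight f t γ m) :=
  ((measurable_ind_fst t).mul (measurable_contrast_snd hf t γ m.2).exp).mul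
    (((hf _).comp measurable_snd).mul ((hf _).comp measurable_snd))

variable {Q : Measure (Fin K × 𝒳)} [IsProbabilityMeasure Q] {B₀ B₁ : ℝ}

theorem integrable_pointLoss (hf : ∀ j, Measurable (f j)) (hb : ∀ᵐ z ∂Q, ∀ j, |f j z.2| ≤ B₀)
    (t : Fin K) (γ : Coef p K) : Integrable (pointLoss f t γ) Q := by
  refine integrable_finsetSum _ fun k _ => ?_
  refine Integrable.of_bound
    (C := Real.exp (2 * B₀ * norm21 γ) + 2 * B₀ * norm21 γ) ?_ ?_
  · exact (((measurable_ind_fst t).mul (measurable_contrast_snd hf t γ k).exp).sub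
      ((measurable_ind_fst k).mul (measurable_contrast_snd hf t γ k))).aestronglyMeasurable
  · filter_upwards [hb] with z hz
    have h := abs_contrast_le f t γ k z.2 hz
    have h1 : |ind t z.1 * Real.exp (contrast f t γ k z.2)| ≤ 1 * Real.exp (2 * B₀ * norm21 γ) := by
      rw [abs_mul, abs_of_nonneg (ind_nonneg _ _), abs_of_pos (Real.exp_pos _)]
      have := ind_le_one t z.1
      have := (le_abs_self _).trans h
      gcongr
    have h2 : |ind k z.1 * contrast f t γ k z.2| ≤ 1 * (2 * B₀ * norm21 γ) := by
      rw [abs_mul, abs_of_nonneg (ind_nonneg _ _)]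
      exact mul_le_mul (ind_le_one _ _) h (abs_nonneg _) zero_le_one
    rw [one_mul] at h1 h2
    exact (abs_sub _ _).trans (add_le_add h1 h2)

theorem integrable_rowGrad (hf : ∀ j, Measurable (f j)) (hb : ∀ᵐ z ∂Q, ∀ j, |f j z.2| ≤ B₀)
    (hB₁ : 1 ≤ B₁) {t : Fin K} {γ : Coef p K}
    (hw : ∀ᵐ z ∂Q, 1 + ∑ k ∈ Finset.univ.erase t, Real.exp (contrast f t γ k z.2) ≤ B₁)
    (j : Fin (p + 1)) : Integrable (rowGrad f t γ j) Q := by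
  refine Integrable.of_bound (C := Real.sqrt 2 * (B₀ * B₁))
    (measurable_rowGrad hf t γ j).aestronglyMeasurable ?_
  filter_upwards [hb, hw] with z h1 h2
  exact norm_rowGrad_le f t γ j z (h1 j) hB₁ h2

omit [MeasurableSpace 𝒳] in
-- A second-order bound with a remainder uniform in the observation, from `|exp u - 1 - u| ≤ u ^ 2`
-- for `|u| ≤ 1`. It replaces differentiation under the integral.
theorem pointLoss_add_smul_le (t : Fin K) (γ b : Coef p K) (z : Fin K × 𝒳) {s c : ℝ}
    (hz : ∀ k, |contrast f t b k z.2| ≤ c) (hs : |s| * c ≤ 1)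
    (hw : 1 + ∑ k ∈ Finset.univ.erase t, Real.exp (contrast f t γ k z.2) ≤ B₁) :
    pointLoss f t (γ + s • b) z
      ≤ pointLoss f t γ z + s * pointDeriv f t γ b z + s ^ 2 * (c ^ 2 * B₁) := by
  have hc : 0 ≤ c := (abs_nonneg _).trans (hz t)
  have h1 : pointLoss f t (γ + s • b) z ≤ pointLoss f t γ z + s * pointDeriv f t γ b z
      + ∑ k ∈ Finset.univ.erase t, s ^ 2 * (c ^ 2 * Real.exp (contrast f t γ k z.2)) := by
    rw [pointLoss, pointLoss, pointDeriv, Finset.mul_sum, ← Finset.sum_add_distrib,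
      ← Finset.sum_add_distrib]
    refine Finset.sum_le_sum fun k _ => ?_
    change ind t z.1 * Real.exp (contrast f t (γ + s • b) k z.2)
      - ind k z.1 * contrast f t (γ + s • b) k z.2 ≤
      ind t z.1 * Real.exp (contrast f t γ k z.2) - ind k z.1 * contrast f t γ k z.2 + _ + _
    rw [contrast_add, contrast_smul, Real.exp_add]
    set d := contrast f t b k z.2 with hd
    set w := Real.exp (contrast f t γ k z.2) with hwdef
    have hw0 : 0 < w := Real.exp_pos _
    have hsd : |s * d| ≤ 1 := by
      rw [abs_mul]
      exact (mul_le_mul_of_nonneg_left (hz k) (abs_nonneg s)).trans hs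
    have hexp := (abs_le.1 (Real.abs_exp_sub_one_sub_id_le hsd)).2
    have hd2 : d ^ 2 ≤ c ^ 2 := sq_le_sq' (abs_le.1 (hz k)).1 (abs_le.1 (hz k)).2
    have h2 : ind t z.1 * (w * (Real.exp (s * d) - 1 - s * d)) ≤ 1 * (w * (s ^ 2 * c ^ 2)) := by
      calc _ ≤ ind t z.1 * (w * (s * d) ^ 2) := by
            have := ind_nonneg t z.1
            gcongr
        _ ≤ 1 * (w * (s * d) ^ 2) := by
            have := ind_le_one t z.1
            gcongr
        _ ≤ _ := by rw [mul_pow]; gcongr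
    linarith
  have h3 : ∑ k ∈ Finset.univ.erase t, s ^ 2 * (c ^ 2 * Real.exp (contrast f t γ k z.2))
      ≤ s ^ 2 * (c ^ 2 * B₁) := by
    rw [← Finset.mul_sum, ← Finset.mul_sum]
    gcongr
    linarith
  linarith

theorem eq_zero_of_forall_quadratic_nonneg {a C δ : ℝ} (hδ : 0 < δ)
    (h : ∀ s, |s| ≤ δ → 0 ≤ s * a + s ^ 2 * C) : a = 0 := by
  have hmin : IsLocalMin (fun s : ℝ => s * a + s ^ 2 * C) 0 := by
    filter_upwards [Metric.closedBall_mem_nhds (0 : ℝ) hδ] with s hs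
    simpa using h s (by simpa [Real.norm_eq_abs] using hs)
  have hd : HasDerivAt (fun s : ℝ => s * a + s ^ 2 * C) a 0 := by
    simpa using ((hasDerivAt_id (0 : ℝ)).mul_const a).fun_add
      (((hasDerivAt_id (0 : ℝ)).fun_pow 2).mul_const C)
  exact hmin.hasDerivAt_eq_zero hd

theorem integral_pointDeriv_eq_zero (hf : ∀ j, Measurable (f j))
    (hb : ∀ᵐ z ∂Q, ∀ j, |f j z.2| ≤ B₀) (hB₀ : 0 < B₀) (hB₁ : 1 ≤ B₁) {t : Fin K} {γ : Coef p K}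
    (hw : ∀ᵐ z ∂Q, 1 + ∑ k ∈ Finset.univ.erase t, Real.exp (contrast f t γ k z.2) ≤ B₁)
    (hγ : IsCALTarget f t Q γ) {b : Coef p K} (hsz : SumToZero b) :
    ∫ z, pointDeriv f t γ b z ∂Q = 0 := by
  -- The `+ 1` keeps `c` positive when `b = 0`.
  set c := 2 * B₀ * norm21 b + 1 with hc
  have hN := norm21_nonneg b
  have hc0 : 0 < c := by positivity
  have hint : Integrable (pointDeriv f t γ b) Q := by
    have : pointDeriv f t γ b = fun z => ∑ j, inner ℝ (WithLp.toLp 2 (b j)) (rowGrad f t γ j z) :=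
      funext (pointDeriv_eq_sum_inner f t γ b)
    rw [this]
    exact integrable_finsetSum _ fun j _ => (integrable_rowGrad hf hb hB₁ hw j).const_inner _
  refine eq_zero_of_forall_quadratic_nonneg (C := c ^ 2 * B₁) (δ := c⁻¹) (inv_pos.2 hc0)
    fun s hs => ?_
  have hs' : |s| * c ≤ 1 := by rwa [← le_div_iff₀ hc0, one_div]
  have h1 := hγ.2 _ (hγ.1.add (hsz.smul s))
  have hI : Integrable (fun z => pointLoss f t γ z + s * pointDeriv f t γ b z) Q :=
    (integrable_pointLoss hf hb t γ).add (hint.const_mul s)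
  have h2 : expLoss f t Q (γ + s • b)
      ≤ ∫ z, (pointLoss f t γ z + s * pointDeriv f t γ b z + s ^ 2 * (c ^ 2 * B₁)) ∂Q := by
    refine integral_mono_ae (integrable_pointLoss hf hb t _)
      (hI.add (integrable_const _)) ?_
    filter_upwards [hb, hw] with z hz hwz
    refine pointLoss_add_smul_le t γ b z (fun k => ?_) hs' hwz
    exact (abs_contrast_le f t b k z.2 hz).trans (by rw [hc]; linarith)
  rw [integral_add hI (integrable_const _),
    integral_add (integrable_pointLoss hf hb t γ) (hint.const_mul s), integral_const_mul,
    integral_const, probReal_univ, one_smul] at h2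
  unfold expLoss at h1 h2
  linarith

/-- The constraint only allows directions such as `e_k - e_t` in row `j`, which show that all
coordinates of the mean are equal. They also sum to zero, because the loss depends on contrasts
alone. -/
theorem integral_rowGrad_eq_zero (hf : ∀ j, Measurable (f j))
    (hb : ∀ᵐ z ∂Q, ∀ j, |f j z.2| ≤ B₀) (hB₀ : 0 < B₀) (hB₁ : 1 ≤ B₁) {t : Fin K} {γ : Coef p K}
    (hw : ∀ᵐ z ∂Q, 1 + ∑ k ∈ Finset.univ.erase t, Real.exp (contrast f t γ k z.2) ≤ B₁)
    (hγ : IsCALTarget f t Q γ) (j : Fin (p + 1)) : ∫ z, rowGrad f t γ j z ∂Q = 0 := by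
  have hint := integrable_rowGrad hf hb hB₁ hw j
  have hcoord : ∀ k, (∫ z, rowGrad f t γ j z ∂Q) k = ∫ z, rowGrad f t γ j z k ∂Q := fun k =>
    ((EuclideanSpace.proj k : EuclideanSpace ℝ (Fin K) →L[ℝ] ℝ).integral_comp_comm hint).symm
  have hintk : ∀ k, Integrable (fun z => rowGrad f t γ j z k) Q := fun k =>
    (EuclideanSpace.proj k : EuclideanSpace ℝ (Fin K) →L[ℝ] ℝ).integrable_comp hint
  have hval : ∀ z k, rowGrad f t γ j z k = f j z.2 * score f t γ z k := fun z k => rfl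
  have hsum : ∑ k, ∫ z, rowGrad f t γ j z k ∂Q = 0 := by
    rw [← integral_finsetSum _ fun k _ => hintk k]
    simp only [hval, ← Finset.mul_sum, sum_score, mul_zero, integral_zero]
  have heq : ∀ k, ∫ z, rowGrad f t γ j z k ∂Q = ∫ z, rowGrad f t γ j z t ∂Q := fun k => by
    set b : Coef p K := Pi.single j (Pi.single k 1 - Pi.single t 1) with hbdef
    have hsz : SumToZero b := fun i => by
      by_cases hi : i = j
      · subst hi; simp [hbdef]
      · simp [hbdef, hi]
    have hlin : ∀ x l, lin f b l x
        = ((Pi.single k 1 - Pi.single t 1 : Fin K → ℝ) l) * f j x := fun x l => by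
      rw [lin, Finset.sum_eq_single j]
      · rw [hbdef, Pi.single_eq_same]
      · intro i _ hi; rw [hbdef, Pi.single_eq_of_ne hi]; simp
      · simp
    have h0 := integral_pointDeriv_eq_zero hf hb hB₀ hB₁ hw hγ hsz
    have hpd : ∀ z, pointDeriv f t γ b z = rowGrad f t γ j z k - rowGrad f t γ j z t := fun z => by
      rw [pointDeriv_eq_sum_score]
      simp only [hlin, hval, Pi.sub_apply, sub_mul, mul_sub, Finset.sum_sub_distrib]
      simp [Pi.single_apply, mul_comm]
    simp only [hpd] at h0
    rw [integral_sub (hintk k) (hintk t)] at h0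
    linarith
  have hzero : ∫ z, rowGrad f t γ j z t ∂Q = 0 := by
    rw [Finset.sum_congr rfl fun k _ => heq k, Finset.sum_const, Finset.card_univ,
      Fintype.card_fin, nsmul_eq_mul] at hsum
    exact (mul_eq_zero.1 hsum).resolve_left (Nat.cast_ne_zero.2 t.pos.ne')
  ext k
  rw [hcoord, heq, hzero]; rfl

end Population

/-! ### Concentration for functions of an i.i.d. sample -/

section Concentration

variable {Ω S : Type*} [MeasurableSpace Ω] [MeasurableSpace S] {P : Measure Ω}
  [IsProbabilityMeasure P] {Q : Measure S} {n : ℕ} {Z : Fin n → Ω → S}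

omit [IsProbabilityMeasure P] in
theorem ae_of_hasLaw {X : Ω → S} (h : HasLaw X Q P) {φ : S → Prop} (hφ : ∀ᵐ s ∂Q, φ s) :
    ∀ᵐ ω ∂P, φ (X ω) :=
  ae_of_ae_map h.aemeasurable (h.map_eq.symm ▸ hφ)

theorem measure_abs_sum_sub_integral_ge_le (hZ : ∀ i, HasLaw (Z i) Q P) (hind : iIndepFun Z P)
    {g : S → ℝ} (hg : Measurable g) {M : ℝ} (hM0 : 0 ≤ M) (hM : ∀ᵐ s ∂Q, |g s| ≤ M) {r : ℝ}
    (hr : 0 ≤ r) :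
    P.real {ω | r ≤ |∑ i, (g (Z i ω) - ∫ s, g s ∂Q)|}
      ≤ 2 * Real.exp (-r ^ 2 / (2 * (n * M ^ 2))) := by
  set X : Fin n → Ω → ℝ := fun i ω => g (Z i ω) - ∫ s, g s ∂Q with hX
  have hint : ∀ i, ∫ ω, g (Z i ω) ∂P = ∫ s, g s ∂Q := fun i => by
    rw [← (hZ i).map_eq, integral_map (hZ i).aemeasurable hg.aestronglyMeasurable]
  have hsub : ∀ i, HasSubgaussianMGF (X i) ((‖M - -M‖₊ / 2) ^ 2) P := fun i => by
    have := hasSubgaussianMGF_of_mem_Icc (μ := P) (X := fun ω => g (Z i ω)) (a := -M) (b := M)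
      (hg.comp_aemeasurable (hZ i).aemeasurable) (by
        filter_upwards [ae_of_hasLaw (hZ i) hM] with ω h using abs_le.1 h)
    rwa [hint i] at this
  have hXind : iIndepFun X P := hind.comp (fun _ s => g s - ∫ s, g s ∂Q) fun _ => hg.sub_const _
  have hXind' : iIndepFun (fun i => -X i) P := hXind.comp (fun _ x => -x) fun _ => measurable_neg
  have hc : ((∑ _i : Fin n, (‖M - -M‖₊ / 2) ^ 2 : NNReal) : ℝ) = n * M ^ 2 := by
    simp only [Finset.sum_const, Finset.card_univ, Fintype.card_fin, nsmul_eq_mul]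
    push_cast
    rw [sub_neg_eq_add, Real.norm_eq_abs, abs_of_nonneg (by linarith)]
    ring
  have h1 := HasSubgaussianMGF.measure_sum_ge_le_of_iIndepFun hXind (s := Finset.univ)
    (fun i _ => hsub i) hr
  have h2 := HasSubgaussianMGF.measure_sum_ge_le_of_iIndepFun hXind' (s := Finset.univ)
    (fun i _ => (hsub i).neg) hr
  rw [hc] at h1 h2
  have hsubset : {ω | r ≤ |∑ i, X i ω|} ⊆ {ω | r ≤ ∑ i, X i ω} ∪ {ω | r ≤ ∑ i, (-X i) ω} := by
    intro ω hω
    rcases le_abs.1 (show r ≤ |∑ i, X i ω| from hω) with h | h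
    · exact Or.inl h
    · exact Or.inr (by simpa using h)
  calc _ ≤ _ := measureReal_mono hsubset
    _ ≤ _ := measureReal_union_le _ _
    _ ≤ _ := by rw [two_mul]; exact add_le_add h1 h2

theorem measure_norm_sum_comp_ge_le {E : Type*} [NormedAddCommGroup E] [InnerProductSpace ℝ E]
    [CompleteSpace E] [SecondCountableTopology E] [MeasurableSpace E] [BorelSpace E]
    (hn : 1 ≤ n) (hZ : ∀ i, HasLaw (Z i) Q P) (hind : iIndepFun Z P)
    {g : S → E} (hg : Measurable g) {M : ℝ} (hM0 : 0 < M) (hM : ∀ᵐ s ∂Q, ‖g s‖ ≤ M)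
    (h0 : ∫ s, g s ∂Q = 0) {r : ℝ} (hr : 0 ≤ r) :
    P.real {ω | n * r ≤ ‖∑ i, g (Z i ω)‖} ≤ 2 * Real.exp (-(n * r ^ 2 / (4 * M ^ 2))) := by
  have h := measure_norm_sum_ge_le (P := P) (fun i ω => g (Z i ω))
    (fun i => hg.comp_aemeasurable (hZ i).aemeasurable) (hind.comp (fun _ => g) fun _ => hg)
    (M := M) (fun i => ae_of_hasLaw (hZ i) hM)
    (fun i => by
      rw [← h0, ← (hZ i).map_eq, integral_map (hZ i).aemeasurable hg.aestronglyMeasurable])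
    -- This `l` minimizes the exponent `n * (l * M) ^ 2 - l * (n * r)`.
    (l := r / (2 * M ^ 2)) (r := n * r) (by positivity)
  refine h.trans (le_of_eq ?_)
  rw [Fintype.card_fin]
  congr 2
  field_simp
  ring

end Concentration

/-! ### The tuning rate and the tail probabilities it yields -/

theorem tuning_pos {p K n : ℕ} {B₀ B₁ ε : ℝ} (hK : 0 < K) (hn : 1 ≤ n) (hB₀ : 0 < B₀) (hB₁ : 0 < B₁)
    (hε : 0 < ε) (hε1 : ε < 1) : 0 < tuning p K n B₀ B₁ ε := by
  have hn' : (0 : ℝ) < n := by exact_mod_cast hn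
  have hK' : (0 : ℝ) < K := by exact_mod_cast hK
  have hp : (0 : ℝ) ≤ p := p.cast_nonneg
  have hL : 0 ≤ Real.log (((p : ℝ) + 1) / ε) :=
    Real.log_nonneg ((one_le_div hε).2 (by linarith))
  unfold tuning
  have : 0 < (K : ℝ) / n + Real.log (((p : ℝ) + 1) / ε) / n := by positivity
  positivity

theorem mul_tuning_sq {p K n : ℕ} {B₀ B₁ ε : ℝ} (hn : 1 ≤ n) (hε : 0 < ε) (hε1 : ε < 1) :
    n * tuning p K n B₀ B₁ ε ^ 2
      = 64 * B₀ ^ 4 * B₁ ^ 2 * (K + Real.log (((p : ℝ) + 1) / ε)) := by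
  have hn' : (0 : ℝ) < n := by exact_mod_cast hn
  have hp : (0 : ℝ) ≤ p := p.cast_nonneg
  have hL : 0 ≤ Real.log (((p : ℝ) + 1) / ε) :=
    Real.log_nonneg ((one_le_div hε).2 (by linarith))
  rw [tuning, mul_pow, Real.sq_sqrt (by positivity)]
  field_simp
  ring

/-- The factor `exp (-2 * K)` pays for the `K` treatments and the constant `2`, and `exp (-2 * L)`
equals `(ε / (p + 1)) ^ 2`, paying for all pairs of regressors. -/
theorem union_bound_arith {p K : ℕ} (hK : 1 ≤ K) {ε : ℝ} (hε : 0 < ε) (hε1 : ε < 1) :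
    ((p : ℝ) + 1) ^ 2 * K * (2 * Real.exp (-(8 * (K + Real.log (((p : ℝ) + 1) / ε))))) ≤ ε := by
  have hp : (0 : ℝ) ≤ p := p.cast_nonneg
  have hK' : (1 : ℝ) ≤ K := by exact_mod_cast hK
  set L := Real.log (((p : ℝ) + 1) / ε) with hL
  have hL0 : 0 ≤ L := Real.log_nonneg ((one_le_div hε).2 (by linarith))
  have hexpL : Real.exp (-L) = ε / ((p : ℝ) + 1) := by
    rw [Real.exp_neg, hL, Real.exp_log (by positivity), inv_div]
  have h1 : Real.exp (-(8 * (K + L))) ≤ Real.exp (-(2 * K)) * Real.exp (-L) ^ 2 := by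
    rw [← Real.exp_nat_mul, ← Real.exp_add]
    refine Real.exp_le_exp.2 ?_
    push_cast
    linarith
  have h2 : 2 * K * Real.exp (-(2 * K)) ≤ 1 := by
    have := mul_le_mul_of_nonneg_right (Real.add_one_le_exp (2 * (K : ℝ)))
      (Real.exp_pos (-(2 * K))).le
    rw [← Real.exp_add, add_neg_cancel, Real.exp_zero] at this
    linarith [Real.exp_pos (-(2 * (K : ℝ)))]
  calc _ ≤ ((p : ℝ) + 1) ^ 2 * K * (2 * (Real.exp (-(2 * K)) * Real.exp (-L) ^ 2)) := by gcongr
    _ = (2 * K * Real.exp (-(2 * K))) * ε ^ 2 := by rw [hexpL]; field_simp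
    _ ≤ 1 * ε ^ 2 := by gcongr
    _ ≤ ε := by nlinarith

section Event

variable {Ω 𝒳 : Type*} [MeasurableSpace Ω] [MeasurableSpace 𝒳] {P : Measure Ω}
  [IsProbabilityMeasure P] {p K n : ℕ} {t : Fin K} {Q : Measure (Fin K × 𝒳)}
  [IsProbabilityMeasure Q] {Z : Fin n → Ω → Fin K × 𝒳} {f : Fin (p + 1) → 𝒳 → ℝ} {γ : Coef p K}
  {B₀ B₁ ε : ℝ}

theorem measure_rowGrad_ge_le (hn : 1 ≤ n) (hZ : ∀ i, HasLaw (Z i) Q P) (hind : iIndepFun Z P)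
    (hf : ∀ j, Measurable (f j)) (hb : ∀ᵐ z ∂Q, ∀ j, |f j z.2| ≤ B₀) (hB₀ : 1 ≤ B₀) (hB₁ : 1 ≤ B₁)
    (hw : ∀ᵐ z ∂Q, 1 + ∑ k ∈ Finset.univ.erase t, Real.exp (contrast f t γ k z.2) ≤ B₁)
    (hγ : IsCALTarget f t Q γ) (hε : 0 < ε) (hε1 : ε < 1) (j : Fin (p + 1)) :
    P.real {ω | n * tuning p K n B₀ B₁ ε ≤ ‖∑ i, rowGrad f t γ j (Z i ω)‖}
      ≤ 2 * Real.exp (-(8 * (K + Real.log (((p : ℝ) + 1) / ε)))) := by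
  have hp : (0 : ℝ) ≤ p := p.cast_nonneg
  have hL0 : 0 ≤ Real.log (((p : ℝ) + 1) / ε) :=
    Real.log_nonneg ((one_le_div hε).2 (by linarith))
  have hM : ∀ᵐ z ∂Q, ‖rowGrad f t γ j z‖ ≤ Real.sqrt 2 * (B₀ * B₁) := by
    filter_upwards [hb, hw] with z h1 h2
    exact norm_rowGrad_le f t γ j z (h1 j) hB₁ h2
  refine (measure_norm_sum_comp_ge_le hn hZ hind (measurable_rowGrad hf t γ j) (by positivity) hM
    (integral_rowGrad_eq_zero hf hb (by linarith) hB₁ hw hγ j)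
    (tuning_pos t.pos hn (by linarith) (by linarith) hε hε1).le).trans ?_
  rw [mul_tuning_sq hn hε hε1, mul_pow (Real.sqrt 2), Real.sq_sqrt (by norm_num)]
  have h1 : 64 * B₀ ^ 4 * B₁ ^ 2 * (K + Real.log (((p : ℝ) + 1) / ε)) / (4 * (2 * (B₀ * B₁) ^ 2))
      = B₀ ^ 2 * (8 * (K + Real.log (((p : ℝ) + 1) / ε))) := by
    field_simp
    ring
  rw [h1]
  -- The score needs only one factor `B₀`, whereas the rate is set for products of two regressors;
  -- the surplus `B₀ ^ 2` is discarded.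
  have h2 : 1 ≤ B₀ ^ 2 := one_le_pow₀ hB₀
  have h3 : 0 ≤ 8 * (K + Real.log (((p : ℝ) + 1) / ε)) := by positivity
  have h4 := le_mul_of_one_le_left h3 h2
  gcongr

omit [IsProbabilityMeasure Q] in
theorem measure_hessWeight_ge_le (hn : 1 ≤ n) (hZ : ∀ i, HasLaw (Z i) Q P) (hind : iIndepFun Z P)
    (hf : ∀ j, Measurable (f j)) (hb : ∀ᵐ z ∂Q, ∀ j, |f j z.2| ≤ B₀) (hB₀ : 1 ≤ B₀) (hB₁ : 1 ≤ B₁)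
    (hw : ∀ᵐ z ∂Q, 1 + ∑ k ∈ Finset.univ.erase t, Real.exp (contrast f t γ k z.2) ≤ B₁)
    (hε : 0 < ε) (hε1 : ε < 1) {m : (Fin (p + 1) × Fin (p + 1)) × Fin K} (hm : m.2 ≠ t) :
    P.real {ω | n * (tuning p K n B₀ B₁ ε / 2) ≤
        |∑ i, (hessWeight f t γ m (Z i ω) - ∫ y, hessWeight f t γ m y ∂Q)|}
      ≤ 2 * Real.exp (-(8 * (K + Real.log (((p : ℝ) + 1) / ε)))) := by
  have hn' : (0 : ℝ) < n := by exact_mod_cast hn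
  have ht := (tuning_pos (p := p) t.pos hn (by linarith : 0 < B₀) (by linarith : 0 < B₁) hε hε1)
  refine (measure_abs_sum_sub_integral_ge_le hZ hind (measurable_hessWeight hf t γ m)
    (M := B₀ ^ 2 * B₁) (by positivity) ?_ (by positivity)).trans (le_of_eq ?_)
  · filter_upwards [hb, hw] with z h1 h2
    exact abs_hessWeight_le f t γ hm z h1 h2
  · congr 2
    have h1 : (n * (tuning p K n B₀ B₁ ε / 2)) ^ 2 = n * (n * tuning p K n B₀ B₁ ε ^ 2) / 4 := by
      ring
    rw [h1, mul_tuning_sq hn hε hε1]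
    field_simp
    ring

end Event

end RCAL

/-! ### The good event and the conclusion -/

theorem mainTheorem11
    {Ω 𝒳 : Type*} [MeasurableSpace Ω] [MeasurableSpace 𝒳]
    (P : Measure Ω) [IsProbabilityMeasure P]
    {p K n : ℕ} (hK : 2 ≤ K) (hn : 1 ≤ n) (t : Fin K)
    -- the law of `(T, X)` and an i.i.d. sample of size `n` from it
    (Q : Measure (Fin K × 𝒳)) [IsProbabilityMeasure Q]
    (Z : Fin n → Ω → Fin K × 𝒳)
    (hZlaw : ∀ i, HasLaw (Z i) Q P) (hZindep : iIndepFun Z P)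
    -- the regressors
    (f : Fin (p + 1) → 𝒳 → ℝ) (hfmeas : ∀ j, Measurable (f j)) (hf0 : ∀ x, f 0 x = 1)
    -- the target value
    (γbar : Coef p K) (hγbar : IsCALTarget f t Q γbar)
    -- the constants
    (B₀ B₁ ν₁ ξ₁ η₁₁ η₁₂ A₁ ε : ℝ)
    (hB₀ : 1 ≤ B₀) (hB₁ : 1 < B₁) (hν₁ : 0 < ν₁) (hξ₁ : 1 < ξ₁)
    (hη₁₁ : 0 < η₁₁ ∧ η₁₁ < 1) (hη₁₂ : 0 < η₁₂ ∧ η₁₂ < 1)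
    (hε : 0 < ε ∧ ε < 1) (hA₁ : (ξ₁ + 1) / (ξ₁ - 1) < A₁)
    -- bounded regressors
    (h_i : ∀ᵐ z ∂Q, ∀ j, j ≠ 0 → |f j z.2| ≤ B₀)
    -- bounded inverse propensity score
    (h_ii : ∀ᵐ z ∂Q, (propensity f t z.2 γbar)⁻¹ ≤ B₁)
    -- compatibility condition
    (h_iii : Compatibility f t Q γbar (activeSet γbar) ν₁ ξ₁)
    -- smallness conditions
    (h_iva : (ξ₁ + 1) ^ 2 * (ν₁ ^ 2)⁻¹ * ((activeSet γbar).card : ℝ) * ((K : ℝ) - 1)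
      * tuning p K n B₀ B₁ ε ≤ η₁₁)
    (h_ivb : 2 * B₀ * (ξ₁ + 1) ^ 2 * (A₁ - 1) * (1 - η₁₁)⁻¹ * (ν₁ ^ 2)⁻¹
      * ((activeSet γbar).card : ℝ) * tuning p K n B₀ B₁ ε ≤ η₁₂) :
    ∃ E : Set Ω, MeasurableSet E ∧ ENNReal.ofReal (1 - 3 * ε) ≤ P E ∧
      ∀ ω ∈ E,
        (∃ γhat : Coef p K,
          IsRCALEstimate f t (fun i => Z i ω) (A₁ * tuning p K n B₀ B₁ ε) γhat) ∧
        ∀ γhat : Coef p K,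
          IsRCALEstimate f t (fun i => Z i ω) (A₁ * tuning p K n B₀ B₁ ε) γhat →
          symBregman f t (fun i => Z i ω) γhat γbar
              + (A₁ - 1) * tuning p K n B₀ B₁ ε * norm21 (γhat - γbar)
            ≤ ((ξ₁ + 1) * (A₁ - 1)) ^ 2
              * ((ν₁ * Real.sqrt (1 - η₁₁) * Real.sqrt (1 - η₁₂)) ^ 2)⁻¹
              * ((activeSet γbar).card : ℝ) * tuning p K n B₀ B₁ ε ^ 2 := by
  obtain ⟨hε0, hε1⟩ := hε
  have hB₀' : 0 < B₀ := by linarith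
  have hKR : (2 : ℝ) ≤ K := by exact_mod_cast hK
  have : Nonempty (Fin K) := ⟨t⟩
  set lt := tuning p K n B₀ B₁ ε with hlt
  have hlt0 : 0 < lt := tuning_pos t.pos hn hB₀' (by linarith) hε0 hε1
  have hb : ∀ᵐ z ∂Q, ∀ j, |f j z.2| ≤ B₀ := by
    filter_upwards [h_i] with z hz j
    by_cases hj : j = 0
    · rw [hj, hf0, abs_one]; exact hB₀
    · exact hz j hj
  have hw : ∀ᵐ z ∂Q, 1 + ∑ k ∈ Finset.univ.erase t, Real.exp (contrast f t γbar k z.2) ≤ B₁ := by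
    filter_upwards [h_ii] with z hz
    rwa [inv_propensity] at hz
  have hint : ∀ m : (Fin (p + 1) × Fin (p + 1)) × Fin K, m.2 ≠ t →
      Integrable (hessWeight f t γbar m) Q := fun m hm => by
    refine Integrable.of_bound (C := B₀ ^ 2 * B₁)
      (measurable_hessWeight hfmeas t γbar m).aestronglyMeasurable ?_
    filter_upwards [hb, hw] with z h1 h2
    exact abs_hessWeight_le f t γbar hm z h1 h2
  set δ := 2 * Real.exp (-(8 * (K + Real.log (((p : ℝ) + 1) / ε)))) with hδ
  have hδ0 : 0 ≤ δ := by positivity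
  set badF : Set Ω := {ω | ¬ ∀ i j, |f j (Z i ω).2| ≤ B₀} with hbadF
  set badG : Fin (p + 1) → Set Ω := fun j =>
    {ω | n * lt ≤ ‖∑ i, rowGrad f t γbar j (Z i ω)‖} with hbadG
  set badH : (Fin (p + 1) × Fin (p + 1)) × Fin K → Set Ω := fun m =>
    {ω | m.2 ≠ t ∧ n * (lt / 2) ≤
      |∑ i, (hessWeight f t γbar m (Z i ω) - ∫ y, hessWeight f t γbar m y ∂Q)|} with hbadH
  set bad : Set Ω := badF ∪ (⋃ j, badG j) ∪ ⋃ m, badH m with hbad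
  have hF : P.real badF = 0 := by
    rw [measureReal_eq_zero_iff]
    exact ae_all_iff.2 fun i => ae_of_hasLaw (hZlaw i) hb
  have hG : P.real (⋃ j, badG j) ≤ ε := by
    calc _ ≤ ∑ j, P.real (badG j) := measureReal_iUnion_fintype_le _
      _ ≤ ∑ _j : Fin (p + 1), δ := Finset.sum_le_sum fun j _ =>
          measure_rowGrad_ge_le hn hZlaw hZindep hfmeas hb hB₀ hB₁.le hw hγbar hε0 hε1 j
      _ = ((p : ℝ) + 1) * 1 * δ := by simp
      _ ≤ ((p : ℝ) + 1) ^ 2 * K * δ := by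
          have : (0 : ℝ) ≤ p := p.cast_nonneg
          gcongr
          · nlinarith
          · linarith
      _ ≤ ε := union_bound_arith t.pos hε0 hε1
  have hH : P.real (⋃ m, badH m) ≤ ε := by
    calc _ ≤ ∑ m, P.real (badH m) := measureReal_iUnion_fintype_le _
      _ ≤ ∑ _m : (Fin (p + 1) × Fin (p + 1)) × Fin K, δ := Finset.sum_le_sum fun m _ => by
          by_cases hm : m.2 = t
          · have : badH m = ∅ := Set.eq_empty_of_forall_notMem fun ω hω => hω.1 hm
            rw [this, measureReal_empty]; exact hδ0
          · refine (measureReal_mono fun ω hω => hω.2).trans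
              (measure_hessWeight_ge_le hn hZlaw hZindep hfmeas hb hB₀ hB₁.le hw hε0 hε1 hm)
      _ = ((p : ℝ) + 1) ^ 2 * K * δ := by
          simp [Fintype.card_prod, sq]
      _ ≤ ε := union_bound_arith t.pos hε0 hε1
  -- The regressor bound fails on a null set only, so the total is `2 * ε`, within the allowed `3 *
  -- ε`.
  have hbadP : P.real bad ≤ 2 * ε := by
    calc _ ≤ _ := measureReal_union_le _ _
      _ ≤ (P.real badF + P.real (⋃ j, badG j)) + P.real (⋃ m, badH m) := by
          gcongr; exact measureReal_union_le _ _
      _ ≤ _ := by rw [hF]; linarith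
  -- A measurable hull of the same measure avoids proving that `bad` is measurable.
  refine ⟨(toMeasurable P bad)ᶜ, (measurableSet_toMeasurable P bad).compl, ?_, fun ω hω => ?_⟩
  · rw [← ofReal_measureReal, probReal_compl_eq_one_sub (measurableSet_toMeasurable P bad)]
    refine ENNReal.ofReal_le_ofReal ?_
    rw [measureReal_def, measure_toMeasurable, ← measureReal_def]
    linarith
  have hωbad : ω ∉ bad := fun h => hω (subset_toMeasurable P bad h)
  simp only [hbad, Set.mem_union, Set.mem_iUnion, not_or, not_exists] at hωbad
  obtain ⟨⟨hωF, hωG⟩, hωH⟩ := hωbad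
  have hgood : ∀ i j, |f j (Z i ω).2| ≤ B₀ := not_not.1 hωF
  have hgrad : ∀ b, SumToZero b → |calDeriv f t (fun i => Z i ω) γbar b| ≤ lt * norm21 b :=
    fun b _ => abs_calDeriv_le f t _ γbar b hn fun j => (not_le.1 (hωG j)).le
  have hhess : ∀ b, SumToZero b → hessForm f t Q γbar b
      ≤ sampleHess f t (fun i => Z i ω) γbar b + ((K : ℝ) - 1) * lt * norm21 b ^ 2 := fun b hsz => by
    refine (hessForm_le f t Q (fun i => Z i ω) γbar b hsz hint (r := lt / 2) (by positivity) hn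
      fun m hm => (not_le.1 fun h => hωH m ⟨hm, h⟩).le).trans ?_
    -- `K / 2 ≤ K - 1` is where `2 ≤ K` enters; it explains the threshold `lt / 2` for the Hessian
    -- weights.
    have hle : lt / 2 * K ≤ ((K : ℝ) - 1) * lt := by nlinarith
    gcongr
  have hκ : 0 ≤ (K : ℝ) - 1 := by linarith
  exact ⟨exists_isRCALEstimate hlt0 hκ hB₀' hν₁ hξ₁ hη₁₁.2 hη₁₂.1 hη₁₂.2 hA₁ hgood hgrad hhess
      h_iii h_iva h_ivb hγbar.1,
    fun γhat hγhat => hγhat.oracle_inequality hlt0 hκ hB₀' hν₁ hξ₁ hη₁₁.2 hη₁₂.1 hη₁₂.2 hA₁ hgood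
      hgrad hhess h_iii h_iva h_ivb hγbar.1⟩
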